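/- For real $a>0$ and $b\ge 0$ let $\mathrm{Bern}_1(a,b)$ be the sequence $Y_1,Y_2,\dots$ of independent $\{0,1\}$-valued random variables with $P(Y_1=1)=1$ and $P(Y_n=1)=\dfrac{a}{a+b+n-2}$ for $n\ge 2$. For $d\ge 1$, a $d$-string occurs at time $n\ge1$ if $\langle Y_n,\dots,Y_{n+d}\rangle=\langle 1,0,\dots,0,1\rangle$ (with $d-1$ zeros). Let $\mathbf Z(a,b)=\langle Z_d:d\ge 1\rangle$ be the count vector, where $Z_d$ is the number of times $n\ge1$ at which a $d$-string occurs. For $m\ge 1$ let $\mathbf W_m$ be the vector whose $m$-th coordinate is $1$ and whose other coordinates are $0$. For $n\ge 2$ let $$p_n=\frac{a}{a+b+n-2}\prod_{r=0}^{n-3}\frac{b+r}{a+b+r}$$ (with empty product $1$, so $p_2=\frac{a}{a+b}$). Proposition 4.2. Let $a>0$ and $b\ge 0$. Then $p_n\ge 0$ is the probability that the second $1$ in $\mathrm{Bern}_1(a,b)$ occurs at time $n$ (for $n\ge 2$), $\sum_{n\ge 2}p_n=1$, and $$\mathcal L\big(\mathbf Z(a,b)\big)=\sum_{n\ge 2}p_n\,\mathcal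 L\big(\mathbf Z(a,b+n-1)+\mathbf W_{n-1}\big).$$ Moreover, if $b>0$ and $n\ge 2$, then $\mathbf Z(a,b+n-1)$, conditional on the value $x_0$ of a $\mathrm{Beta}(b+n-2,a+1)$ random variable, is distributed as $\prod_{k\ge 1}\mathrm{Po}\big(a(1-x_0^k)/k\big)$; that is, its law is the mixture of these products of independent Poisson laws over the law $\mathrm{Beta}(b+n-2,a+1)$ of $x_0$. -/

import Mathlib

open MeasureTheory ProbabilityTheory
open scoped ENNReal NNReal

namespace BernoulliStrings

/-- A `{0,1}`-valued sequence `y₁, y₂, …`, indexed by the times `1, 2, …`;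
`true` is the value `1`, `false` is the value `0`. -/
abbrev BinSeq : Type := ℕ+ → Bool

/-- A count vector `⟨z₁, z₂, …⟩`; a count may a priori be infinite. -/
abbrev CountVec : Type := ℕ+ → ℕ∞

/-- A `d`-string occurs at time `n`: `⟨y_n, …, y_{n+d}⟩ = ⟨1, 0, …, 0, 1⟩` with `d - 1` zeros. -/
def StringAt (y : BinSeq) (d n : ℕ+) : Prop :=
  y n = true ∧ (∀ i : ℕ+, n < i → i < n + d → y i = false) ∧ y (n + d) = true

/-- The count vector of `y`: its `d`-th coordinate is the number of times
at which a `d`-string occurs. -/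
noncomputable def countVector (y : BinSeq) : CountVec :=
  fun d => Set.encard {n : ℕ+ | StringAt y d n}

/-- The count vector is a measurable function of the sequence. -/
theorem measurable_countVector : Measurable countVector := by
  refine measurable_pi_lambda _ fun d => measurable_encard.comp (measurable_set_iff.2 fun n => ?_)
  have hm : ∀ m : ℕ+, Measurable fun y : BinSeq => y m := fun m => measurable_pi_apply m
  refine measurable_to_prop ?_
  have h : (fun y : BinSeq => (n ∈ {n : ℕ+ | StringAt y d n})) ⁻¹' {True} =
      (fun y : BinSeq => y n) ⁻¹' {true} ∩
        ((⋂ i : ℕ+, ⋂ _ : n < i, ⋂ _ : i < n + d, (fun y : BinSeq => y i) ⁻¹' {false}) ∩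
          (fun y : BinSeq => y (n + d)) ⁻¹' {true}) := by
    ext y
    simp [StringAt]
  rw [h]
  refine (hm _ .of_discrete).inter (.inter ?_ (hm _ .of_discrete))
  exact .iInter fun i => .iInter fun _ => .iInter fun _ => hm _ .of_discrete

/-- The success probabilities of `Bern₁(a,b)`: `1` at time `1` and `a / (a + b + n - 2)` at
time `n ≥ 2`. -/
noncomputable def bernOneProb (a b : ℝ) (n : ℕ+) : ℝ :=
  if n = 1 then 1 else a / (a + b + (n : ℝ) - 2)

/-- The law of the sequence `Bern₁(a,b)`: independent coordinates, the `n`-th one being `1` with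
probability `bernOneProb a b n` and `0` otherwise. (For `a > 0`, `b ≥ 0` these numbers lie
in `[0,1]`, so that the projection onto `[0,1]` does nothing.) -/
noncomputable def bernOneLaw (a b : ℝ) : Measure BinSeq :=
  Measure.infinitePi fun n : ℕ+ =>
    bernoulliMeasure true false (Set.projIcc (0 : ℝ) 1 zero_le_one (bernOneProb a b n))

/-- The law of the count vector `Z(a,b)` of `Bern₁(a,b)`. -/
noncomputable def countLaw (a b : ℝ) : Measure CountVec :=
  (bernOneLaw a b).map countVector

/-- The second `1` of `y` occurs at time `n`. -/
def SecondOneAt (y : BinSeq) (n : ℕ) : Prop :=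
  ∃ m : ℕ+, (m : ℕ) = n ∧ y m = true ∧ ∃! i : ℕ+, i < m ∧ y i = true

/-- `p_n = a / (a + b + n - 2) * ∏_{r = 0}^{n - 3} (b + r) / (a + b + r)` for `n ≥ 2`;
the product is empty for `n = 2`, where the value is `a / (a + b)`. -/
noncomputable def secondOneProb (a b : ℝ) (n : ℕ) : ℝ :=
  a / (a + b + (n : ℝ) - 2) * ∏ r ∈ Finset.range (n - 2), (b + (r : ℝ)) / (a + b + (r : ℝ))

/-- The vector `W_n`, whose `n`-th coordinate is `1` and whose other coordinates are `0`. -/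
def unitVec (n : ℕ) : CountVec := fun k => if (k : ℕ) = n then 1 else 0

/-- The product over `k ≥ 1` of the Poisson laws with means `a (1 - x ^ k) / k`
(these means are nonnegative for `a ≥ 0` and `0 ≤ x ≤ 1`). -/
noncomputable def poissonProduct (a x : ℝ) : Measure CountVec :=
  Measure.infinitePi fun k : ℕ+ =>
    (poissonMeasure (Real.toNNReal (a * (1 - x ^ (k : ℕ)) / (k : ℝ)))).map (Nat.cast : ℕ → ℕ∞)

end BernoulliStrings

/-! The mixture over `n` is a regeneration at the second 1. Since the first entry is 1, the second 1
falls at time `m + 1` exactly when an `m`-string starts at time 1. On that event the sequence from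
time `m + 1` on begins with a 1, is otherwise independent of the past, and follows the same scheme
with `b` replaced by `b + m`. It carries every string except the first
(`countVector_of_stringAt_one`, `map_shift_restrict`). The weights `p_n` telescope, and their sum is
1 because the harmonic series diverges.

For the Poisson mixture, let `U_c(z)` be the probability of a cylinder `z` on a fixed finite set `I`
of coordinates, either under `Z(a,c+1)` or under the `Beta(c,a+1)` mixture. Both families satisfy
`U_c(z) = ∑_m p_{m+1} U_{c+m}(z - e_m)`, with `p` taken at `(a,c+1)`. For the counts this is the
regeneration. For the mixture it is an integration by parts (`hasSum_betaPoissonIntegral`):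
differentiating a Poisson product lowers one coordinate of `z` by 1, and a geometric series supplies
the coordinates outside `I`. Ratios of Beta functions then turn into the weights
(`secondOneProb_eq_beta_ratio`).

The recursion has only one solution with the right behaviour at infinity
(`eq_of_averaging_recursion`). Both laws give a nonzero `d`-th count probability `O(1/c)`, so the
two cylinder probabilities differ by `O(1/c)`, uniformly in `z`. Each use of the recursion raises
`c` by at least 1, so the difference is `O(1/(c+N))` for every `N`, hence zero. -/

namespace BernoulliStrings

open Filter Topology

/-! ### The time of the second 1 -/

section Sequence

theorem bernOneProb_one (a b : ℝ) : bernOneProb a b 1 = 1 := by simp [bernOneProb]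

theorem bernOneProb_of_ne_one (a b : ℝ) {n : ℕ+} (hn : n ≠ 1) :
    bernOneProb a b n = a / (a + b + (n : ℝ) - 2) := by simp [bernOneProb, hn]

theorem two_le_cast_of_ne_one {n : ℕ+} (hn : n ≠ 1) : (2 : ℝ) ≤ (n : ℝ) := by
  have h : 1 < n := lt_of_le_of_ne one_le (Ne.symm hn)
  have h2 : 2 ≤ (n : ℕ) := h
  exact_mod_cast h2

theorem bernOneProb_mem {a b : ℝ} (ha : 0 < a) (hb : 0 ≤ b) (n : ℕ+) :
    bernOneProb a b n ∈ Set.Icc (0 : ℝ) 1 := by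
  by_cases hn : n = 1
  · simp [hn, bernOneProb_one]
  · have h2 := two_le_cast_of_ne_one hn
    rw [bernOneProb_of_ne_one a b hn]
    exact ⟨div_nonneg ha.le (by linarith), (div_le_one (by linarith)).2 (by linarith)⟩

/-- The law of the `n`-th coordinate of `Bern₁(a,b)`. -/
noncomputable def bernOneMarginal (a b : ℝ) (n : ℕ+) : Measure Bool :=
  bernoulliMeasure true false (Set.projIcc (0 : ℝ) 1 zero_le_one (bernOneProb a b n))

instance (a b : ℝ) (n : ℕ+) : IsProbabilityMeasure (bernOneMarginal a b n) := by
  unfold bernOneMarginal; infer_instance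

theorem bernOneLaw_eq (a b : ℝ) : bernOneLaw a b = Measure.infinitePi (bernOneMarginal a b) := rfl

instance (a b : ℝ) : IsProbabilityMeasure (bernOneLaw a b) := by
  rw [bernOneLaw_eq]; infer_instance

instance (a b : ℝ) : IsProbabilityMeasure (countLaw a b) :=
  Measure.isProbabilityMeasure_map measurable_countVector.aemeasurable

theorem bernOneMarginal_true {a b : ℝ} (ha : 0 < a) (hb : 0 ≤ b) (n : ℕ+) :
    bernOneMarginal a b n {true} = ENNReal.ofReal (bernOneProb a b n) := by
  rw [bernOneMarginal, bernoulliMeasure_apply_of_mem_of_notMem _ (by simp) (by simp) (by simp),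
    Set.projIcc_of_mem _ (bernOneProb_mem ha hb n), ENNReal.ofReal]
  congr 1
  ext
  simp [(bernOneProb_mem ha hb n).1]

theorem bernOneMarginal_false {a b : ℝ} (ha : 0 < a) (hb : 0 ≤ b) (n : ℕ+) :
    bernOneMarginal a b n {false} = ENNReal.ofReal (1 - bernOneProb a b n) := by
  have h1 : ({false} : Set Bool) = {true}ᶜ := by ext x; cases x <;> simp
  rw [h1, prob_compl_eq_one_sub (by simp), bernOneMarginal_true ha hb,
    ENNReal.ofReal_sub _ (bernOneProb_mem ha hb n).1, ENNReal.ofReal_one]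

theorem add_ne_one (n m : ℕ+) : n + m ≠ 1 :=
  ((one_le (a := n)).trans_lt (PNat.lt_add_right n m)).ne'

theorem bernOneMarginal_shift {a b : ℝ} (m : ℕ+) {n : ℕ+} (hn : n ≠ 1) :
    bernOneMarginal a b (n + m) = bernOneMarginal a (b + (m : ℝ)) n := by
  have h : n + m ≠ 1 := add_ne_one n m
  rw [bernOneMarginal, bernOneMarginal, bernOneProb_of_ne_one _ _ hn, bernOneProb_of_ne_one _ _ h]
  congr 3
  push_cast
  ring

theorem bernOneMarginal_one (a b : ℝ) : bernOneMarginal a b 1 = Measure.dirac true := by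
  rw [bernOneMarginal, bernOneProb_one, Set.projIcc_right]
  exact bernoulliMeasure_one true false

theorem measurableSet_stringAt (d n : ℕ+) : MeasurableSet {y : BinSeq | StringAt y d n} := by
  have hm : ∀ (m : ℕ+) (c : Bool), MeasurableSet {y : BinSeq | y m = c} := fun m c =>
    (measurable_pi_apply (X := fun _ : ℕ+ => Bool) m) (measurableSet_singleton c)
  have h : {y : BinSeq | StringAt y d n} = {y | y n = true} ∩
      ((⋂ i : ℕ+, ⋂ _ : n < i, ⋂ _ : i < n + d, {y | y i = false}) ∩ {y | y (n + d) = true}) := by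
    ext y
    simp [StringAt]
  rw [h]
  exact (hm _ _).inter
    (.inter (.iInter fun i => .iInter fun _ => .iInter fun _ => hm _ _) (hm _ _))

theorem ae_first_eq_true (a b : ℝ) : ∀ᵐ y ∂bernOneLaw a b, y 1 = true := by
  have h := Measure.infinitePi_map_eval (bernOneMarginal a b) 1
  rw [bernOneMarginal_one, ← bernOneLaw_eq] at h
  have h2 : ∀ᵐ c ∂(bernOneLaw a b).map (Function.eval (1 : ℕ+)), c = true := by
    rw [h, ae_dirac_eq]
    rfl
  exact ae_of_ae_map (measurable_pi_apply (1 : ℕ+)).aemeasurable h2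

theorem prod_Ioo_one_eq_prod_range (f : ℝ → ℝ) (m : ℕ+) :
    ∏ i ∈ Finset.Ioo 1 (1 + m), f ((i : ℝ)) = ∏ r ∈ Finset.range ((m : ℕ) - 1), f ((r : ℝ) + 2) := by
  refine Finset.prod_nbij' (fun i : ℕ+ => (i : ℕ) - 2) (fun r => (r + 1).succPNat) ?_ ?_ ?_ ?_ ?_
  · intro i hi
    rw [Finset.mem_Ioo, ← PNat.coe_lt_coe, ← PNat.coe_lt_coe, PNat.add_coe, PNat.one_coe] at hi
    rw [Finset.mem_range]
    omega
  · intro r hr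
    rw [Finset.mem_range] at hr
    rw [Finset.mem_Ioo, ← PNat.coe_lt_coe, ← PNat.coe_lt_coe, PNat.add_coe, PNat.one_coe,
      Nat.succPNat_coe]
    omega
  · intro i hi
    rw [Finset.mem_Ioo, ← PNat.coe_lt_coe, ← PNat.coe_lt_coe, PNat.add_coe, PNat.one_coe] at hi
    rw [← PNat.coe_inj, Nat.succPNat_coe]
    omega
  · intro r _
    simp
  · intro i hi
    rw [Finset.mem_Ioo, ← PNat.coe_lt_coe, ← PNat.coe_lt_coe, PNat.add_coe, PNat.one_coe] at hi
    congr 1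
    have : (i : ℕ) = ((i : ℕ) - 2) + 2 := by omega
    exact_mod_cast this

/-- The event is a cylinder on the times `1, …, 1 + m`, so its probability is a product. The zero at
time `i` contributes `1 - a/(a+b+i-2) = (b+i-2)/(a+b+i-2)`. -/
theorem bernOneLaw_stringAt_one {a b : ℝ} (ha : 0 < a) (hb : 0 ≤ b) (m : ℕ+) :
    bernOneLaw a b {y | StringAt y m 1} = ENNReal.ofReal (secondOneProb a b ((m : ℕ) + 1)) := by
  set t : ℕ+ → Set Bool := fun i => if i = 1 ∨ i = 1 + m then {true} else {false} with ht
  have hne : (1 : ℕ+) ≠ 1 + m := (add_ne_one 1 m).symm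
  have hset : {y : BinSeq | StringAt y m 1} =
      Set.pi (↑(insert 1 (insert (1 + m) (Finset.Ioo 1 (1 + m)))) : Set ℕ+) t := by
    ext y
    simp only [Set.mem_ofPred_eq, StringAt, Finset.coe_insert, Set.mem_pi, Set.mem_insert_iff,
      Finset.mem_coe, Finset.mem_Ioo, ht]
    constructor
    · rintro ⟨h1, h2, h3⟩ i (rfl | rfl | hi)
      · simpa using h1
      · simpa using h3
      · have : ¬ (i = 1 ∨ i = 1 + m) := by
          rintro (h | h)
          · exact hi.1.ne' h
          · exact hi.2.ne h
        simpa [this] using h2 i hi.1 hi.2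
    · intro h
      refine ⟨by simpa using h 1 (Or.inl rfl), fun i hi hi' => ?_,
        by simpa using h (1 + m) (Or.inr (Or.inl rfl))⟩
      have : ¬ (i = 1 ∨ i = 1 + m) := by
        rintro (h | h)
        · exact hi.ne' h
        · exact hi'.ne h
      simpa [this] using h i (Or.inr (Or.inr ⟨hi, hi'⟩))
  rw [hset, bernOneLaw_eq, Measure.infinitePi_pi _ (fun _ _ => .of_discrete),
    Finset.prod_insert (by simp [hne]), Finset.prod_insert (by simp)]
  have h1 : bernOneMarginal a b 1 (t 1) = 1 := by
    simp [ht, bernOneMarginal_true ha hb, bernOneProb_one]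
  have h2 : bernOneMarginal a b (1 + m) (t (1 + m)) =
      ENNReal.ofReal (a / (a + b + (((m : ℕ) + 1 : ℕ) : ℝ) - 2)) := by
    simp only [ht, or_true, if_true]
    rw [bernOneMarginal_true ha hb, bernOneProb_of_ne_one _ _ hne.symm]
    push_cast
    ring_nf
  have h3 : ∏ i ∈ Finset.Ioo 1 (1 + m), bernOneMarginal a b i (t i) =
      ∏ i ∈ Finset.Ioo 1 (1 + m), ENNReal.ofReal ((b + ((i : ℝ) - 2)) / (a + b + ((i : ℝ) - 2))) := by
    refine Finset.prod_congr rfl fun i hi => ?_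
    rw [Finset.mem_Ioo] at hi
    have hi1 : i ≠ 1 := hi.1.ne'
    have : ¬ (i = 1 ∨ i = 1 + m) := by
      rintro (h | h)
      · exact hi1 h
      · exact hi.2.ne h
    simp only [ht, this, if_false]
    have h2 := two_le_cast_of_ne_one hi1
    rw [bernOneMarginal_false ha hb, bernOneProb_of_ne_one _ _ hi1]
    congr 1
    have : a + b + (i : ℝ) - 2 ≠ 0 := by linarith
    have : a + b + ((i : ℝ) - 2) ≠ 0 := by linarith
    field_simp
    ring
  have hnn : ∀ i ∈ Finset.Ioo 1 (1 + m),
      0 ≤ (b + ((i : ℝ) - 2)) / (a + b + ((i : ℝ) - 2)) := by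
    intro i hi
    rw [Finset.mem_Ioo] at hi
    have h2 := two_le_cast_of_ne_one hi.1.ne'
    exact div_nonneg (by linarith) (by linarith)
  have hm : (1 : ℝ) ≤ (m : ℝ) := by exact_mod_cast (one_le (a := m))
  rw [h1, h2, h3, one_mul, ← ENNReal.ofReal_prod_of_nonneg hnn, ← ENNReal.ofReal_mul
    (div_nonneg ha.le (by push_cast; linarith)),
    prod_Ioo_one_eq_prod_range (fun x => (b + (x - 2)) / (a + b + (x - 2))) m, secondOneProb]
  congr 3
  funext r
  ring_nf

theorem secondOneProb_nonneg {a b : ℝ} (ha : 0 < a) (hb : 0 ≤ b) {n : ℕ} (hn : 2 ≤ n) :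
    0 ≤ secondOneProb a b n := by
  have : (2 : ℝ) ≤ n := by exact_mod_cast hn
  exact mul_nonneg (div_nonneg ha.le (by linarith))
    (Finset.prod_nonneg fun r _ => div_nonneg (by positivity) (by positivity))

theorem secondOneAt_iff_stringAt_one {y : BinSeq} (hy : y 1 = true) (m : ℕ+) :
    SecondOneAt y ((m : ℕ) + 1) ↔ StringAt y m 1 := by
  have hlt : (1 : ℕ+) < 1 + m := PNat.lt_add_right 1 m
  constructor
  · rintro ⟨k, hk, hk1, i, ⟨-, -⟩, huniq⟩
    have hk' : k = 1 + m := by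
      rw [← PNat.coe_inj, hk, PNat.add_coe, PNat.one_coe, add_comm]
    subst hk'
    refine ⟨hy, fun j hj hj' => ?_, hk1⟩
    by_contra hc
    have h1 := huniq j ⟨hj', by simpa using hc⟩
    have h2 := huniq 1 ⟨hlt, hy⟩
    exact hj.ne' (h1.trans h2.symm)
  · rintro ⟨-, h2, h3⟩
    refine ⟨1 + m, by rw [PNat.add_coe, PNat.one_coe, add_comm], h3, 1, ⟨hlt, hy⟩, ?_⟩
    rintro j ⟨hj, hj1⟩
    by_contra hc
    have := h2 j (lt_of_le_of_ne one_le (Ne.symm hc)) hj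
    simp [hj1] at this

theorem bernOneLaw_secondOneAt {a b : ℝ} (ha : 0 < a) (hb : 0 ≤ b) {n : ℕ} (hn : 2 ≤ n) :
    bernOneLaw a b {y | SecondOneAt y n} = ENNReal.ofReal (secondOneProb a b n) := by
  obtain ⟨m, rfl⟩ : ∃ m : ℕ+, n = (m : ℕ) + 1 :=
    ⟨⟨n - 1, by omega⟩, by rw [PNat.mk_coe]; omega⟩
  rw [← bernOneLaw_stringAt_one ha hb m]
  refine measure_congr ?_
  filter_upwards [ae_first_eq_true a b] with y hy
  exact propext (secondOneAt_iff_stringAt_one hy m)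

/-- Each factor is `1 - a/(a+b+r)`; bounding `1 - t` by `exp (-t)` reduces the claim to divergence
of the harmonic series. -/
theorem tendsto_prod_ratio_zero {a b : ℝ} (ha : 0 < a) (hb : 0 ≤ b) :
    Tendsto (fun N : ℕ => ∏ r ∈ Finset.range N, (b + (r : ℝ)) / (a + b + (r : ℝ))) atTop (𝓝 0) := by
  -- This constant gives `c/(r+1) ≤ a/(a+b+r)` for all `r ≥ 0`, since `a+b+r ≤ (a+b+1)(r+1)`.
  set c := a / (a + b + 1) with hc
  have hc0 : 0 < c := by positivity
  have hle : ∀ N : ℕ, ∏ r ∈ Finset.range N, (b + (r : ℝ)) / (a + b + (r : ℝ)) ≤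
      Real.exp (-(c * ∑ r ∈ Finset.range N, 1 / ((r : ℝ) + 1))) := by
    intro N
    rw [Finset.mul_sum, ← Finset.sum_neg_distrib, Real.exp_sum]
    refine Finset.prod_le_prod (fun r _ => by positivity) fun r _ => ?_
    have h1 : (b + (r : ℝ)) / (a + b + (r : ℝ)) = 1 - a / (a + b + r) := by
      have : a + b + (r : ℝ) ≠ 0 := by positivity
      field_simp
      ring
    have h2 : c * (1 / ((r : ℝ) + 1)) ≤ a / (a + b + r) := by
      rw [hc, div_mul_div_comm, mul_one]
      refine div_le_div_of_nonneg_left ha.le (by positivity) ?_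
      nlinarith [mul_nonneg (add_nonneg ha.le hb) (Nat.cast_nonneg (α := ℝ) r)]
    rw [h1]
    linarith [Real.add_one_le_exp (-(c * (1 / ((r : ℝ) + 1))))]
  refine squeeze_zero (fun N => Finset.prod_nonneg fun r _ => by positivity) hle ?_
  refine Real.tendsto_exp_atBot.comp (tendsto_neg_atTop_atBot.comp ?_)
  exact Real.tendsto_sum_range_one_div_nat_succ_atTop.const_mul_atTop hc0

theorem hasSum_secondOneProb_add_two {a b : ℝ} (ha : 0 < a) (hb : 0 ≤ b) :
    HasSum (fun j : ℕ => secondOneProb a b (j + 2)) 1 := by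
  rw [hasSum_iff_tendsto_nat_of_nonneg fun j => secondOneProb_nonneg ha hb (by omega)]
  -- The product is the probability that no second 1 has occurred up to time `N + 1`.
  have hsum : ∀ N : ℕ, ∑ j ∈ Finset.range N, secondOneProb a b (j + 2) =
      1 - ∏ r ∈ Finset.range N, (b + (r : ℝ)) / (a + b + (r : ℝ)) := by
    intro N
    induction N with
    | zero => simp
    | succ N ih =>
      rw [Finset.sum_range_succ, ih, Finset.prod_range_succ, secondOneProb, Nat.add_sub_cancel]
      have h1 : a + b + ((N + 2 : ℕ) : ℝ) - 2 = a + b + N := by push_cast; ring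
      have h2 : a + b + (N : ℝ) ≠ 0 := by positivity
      rw [h1]
      field_simp
      ring
  simp_rw [hsum]
  simpa using (tendsto_prod_ratio_zero ha hb).const_sub 1

/-- The positive integer `m` corresponds to the time `m + 1 ≥ 2`. -/
def pnatEquivTwoLe : ℕ+ ≃ {n : ℕ // 2 ≤ n} where
  toFun m := ⟨(m : ℕ) + 1, by have := m.pos; omega⟩
  invFun n := ⟨(n : ℕ) - 1, by have := n.2; omega⟩
  left_inv m := PNat.eq (by simp)
  right_inv n := by ext; have := n.2; simp; omega

theorem hasSum_secondOneProb_pnat {a b : ℝ} (ha : 0 < a) (hb : 0 ≤ b) :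
    HasSum (fun m : ℕ+ => secondOneProb a b ((m : ℕ) + 1)) 1 := by
  rw [← Equiv.pnatEquivNat.symm.hasSum_iff]
  exact hasSum_secondOneProb_add_two ha hb

theorem hasSum_secondOneProb {a b : ℝ} (ha : 0 < a) (hb : 0 ≤ b) :
    HasSum (fun n : {n : ℕ // 2 ≤ n} => secondOneProb a b n) 1 := by
  rw [← pnatEquivTwoLe.hasSum_iff]
  exact hasSum_secondOneProb_pnat ha hb

end Sequence

/-! ### Regeneration at the second 1 -/

section Decomposition

/-- The sequence seen after time `m`. -/
def shift (m : ℕ+) (y : BinSeq) : BinSeq := fun k => y (k + m)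

theorem measurable_shift (m : ℕ+) : Measurable (shift m) :=
  measurable_pi_lambda _ fun k => measurable_pi_apply (k + m)

theorem stringAt_shift (y : BinSeq) (d m n : ℕ+) :
    StringAt (shift m y) d n ↔ StringAt y d (n + m) := by
  have h : n + d + m = n + m + d := by rw [add_right_comm]
  unfold StringAt shift
  rw [h]
  refine and_congr_right fun _ => and_congr_left fun _ => ⟨fun H i hi hi' => ?_, fun H i hi hi' => ?_⟩
  · have hmi : m < i := (PNat.lt_add_left m n).trans hi
    have hi2 : i - m + m = i := by rw [add_comm]; exact PNat.add_sub_of_lt hmi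
    rw [← hi2] at hi hi' ⊢
    refine H _ (lt_of_add_lt_add_right hi) (lt_of_add_lt_add_right (a := m) ?_)
    rwa [h]
  · refine H _ (by gcongr) ?_
    rw [← h]
    gcongr

theorem StringAt.unique {y : BinSeq} {d e n : ℕ+} (hd : StringAt y d n) (he : StringAt y e n) :
    d = e := by
  rcases lt_trichotomy d e with h | h | h
  · have := he.2.1 (n + d) (PNat.lt_add_right n d) (by gcongr)
    simp [hd.2.2] at this
  · exact h
  · have := hd.2.1 (n + e) (PNat.lt_add_right n e) (by gcongr)
    simp [he.2.2] at this

/-- The entries at times `2, …, m` are 0, so every string starts at time 1, where only the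
`m`-string fits, or after time `m`, where it is a string of the shifted sequence. -/
theorem countVector_of_stringAt_one {y : BinSeq} {m : ℕ+} (hy : StringAt y m 1) :
    countVector y = countVector (shift m y) + unitVec m := by
  funext d
  have hset : {n : ℕ+ | StringAt y d n} =
      (fun n => n + m) '' {n : ℕ+ | StringAt (shift m y) d n} ∪ {n : ℕ+ | n = 1 ∧ d = m} := by
    ext n
    simp only [Set.mem_ofPred_eq, Set.mem_union, Set.mem_image, stringAt_shift]
    constructor
    · intro hn
      rcases lt_or_ge m n with h | h
      · left
        refine ⟨n - m, ?_⟩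
        have hi2 : n - m + m = n := by rw [add_comm]; exact PNat.add_sub_of_lt h
        rw [hi2]
        exact ⟨hn, rfl⟩
      · right
        have h1 : n = 1 := by
          by_contra hc
          have := hy.2.1 n (lt_of_le_of_ne one_le (Ne.symm hc))
            (h.trans_lt (PNat.lt_add_left m 1))
          simp [hn.1] at this
        subst h1
        exact ⟨rfl, hn.unique hy⟩
    · rintro (⟨k, hk, rfl⟩ | ⟨rfl, rfl⟩)
      · exact hk
      · exact hy
  have hdisj : Disjoint ((fun n => n + m) '' {n : ℕ+ | StringAt (shift m y) d n})
      {n : ℕ+ | n = 1 ∧ d = m} := by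
    rw [Set.disjoint_left]
    rintro _ ⟨k, -, rfl⟩ ⟨h, -⟩
    exact add_ne_one k m h
  change Set.encard _ = Set.encard _ + unitVec m d
  rw [hset, Set.encard_union_eq hdisj, (add_left_injective m).injOn.encard_image]
  congr 1
  unfold unitVec
  by_cases h : d = m
  · subst h; simp
  · simp [h]

/-- The sequence seen after time `m`, with its first entry replaced by `1`. -/
def shiftOne (m : ℕ+) (y : BinSeq) : BinSeq := fun k => if k = 1 then true else y (k + m)

/-- At index `k ≥ 2` the shift of time is absorbed by `b`, since only `b + k` enters the success
probability. At `k = 1` this fails, but there the entry is forced to be 1. -/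
theorem map_shiftOne (a b : ℝ) (m : ℕ+) :
    (bernOneLaw a b).map (shiftOne m) = bernOneLaw a (b + (m : ℝ)) := by
  have h1 := Measure.map_infinitePi_infinitePi_of_inj (P := bernOneMarginal a b)
    (f := fun k : ℕ+ => k + m) (add_left_injective m)
  have h2 := Measure.infinitePi_map_pi (fun k : ℕ+ => bernOneMarginal a b (k + m))
    (f := fun k c => if k = 1 then true else c) (fun k => .of_discrete)
  rw [← h1, Measure.map_map (by fun_prop) (by fun_prop), ← bernOneLaw_eq] at h2
  change Measure.map (shiftOne m) _ = _ at h2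
  rw [h2, bernOneLaw_eq]
  congr 1
  funext k
  by_cases hk : k = 1
  · subst hk
    simp only [if_true, bernOneMarginal_one]
    rw [Measure.map_const, measure_univ, one_smul]
  · simp only [hk, if_false]
    rw [← bernOneMarginal_shift m hk]
    exact Measure.map_id

/-- An `m`-string at time 1 fixes the entry at time `1 + m`, so `shift m` and the event share a
coordinate. On the event `shift m` equals `shiftOne m`, which reads only times after `1 + m` and is
therefore independent of it. -/
theorem bernOneLaw_inter_shift {a b : ℝ} (ha : 0 < a) (hb : 0 ≤ b) (m : ℕ+) {T : Set BinSeq}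
    (hT : MeasurableSet T) :
    bernOneLaw a b ({y | StringAt y m 1} ∩ shift m ⁻¹' T) =
      ENNReal.ofReal (secondOneProb a b ((m : ℕ) + 1)) * bernOneLaw a (b + (m : ℝ)) T := by
  have hinter : {y : BinSeq | StringAt y m 1} ∩ shift m ⁻¹' T =
      {y | StringAt y m 1} ∩ shiftOne m ⁻¹' T := by
    ext y
    refine and_congr_right fun hy => ?_
    have : shift m y = shiftOne m y := by
      funext k
      by_cases hk : k = 1
      · subst hk
        simpa [shift, shiftOne] using hy.2.2
      · simp [shift, shiftOne, hk]
    simp [this]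
  let mc : ℕ+ → MeasurableSpace BinSeq := fun i => MeasurableSpace.comap (fun y => y i) inferInstance
  have hind : iIndepFun (fun (i : ℕ+) (y : BinSeq) => y i) (bernOneLaw a b) :=
    iIndepFun_infinitePi (P := bernOneMarginal a b) (X := fun _ c => c) (fun _ => measurable_id)
  have hle : ∀ i, mc i ≤ MeasurableSpace.pi := fun i => (measurable_pi_apply i).comap_le
  have hI := indep_iSup_of_disjoint hle hind (S := Set.Iic (1 + m)) (T := Set.Ioi (1 + m))
    (Set.Iic_disjoint_Ioi le_rfl)
  rw [Indep_iff] at hI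
  have hev : ∀ (S : Set ℕ+) (i : ℕ+), i ∈ S → ∀ c : Bool,
      MeasurableSet[⨆ i ∈ S, mc i] {y : BinSeq | y i = c} := fun S i hi c =>
    (le_iSup₂ (f := fun (i : ℕ+) (_ : i ∈ S) => mc i) i hi) _
      ⟨{c}, measurableSet_singleton c, rfl⟩
  rw [hinter, hI, bernOneLaw_stringAt_one ha hb, ← map_shiftOne a b m, Measure.map_apply _ hT]
  · refine measurable_pi_lambda _ fun k => ?_
    by_cases hk : k = 1
    · simp [shiftOne, hk]
    · simpa [shiftOne, hk] using measurable_pi_apply (k + m)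
  · have h : {y : BinSeq | StringAt y m 1} = {y | y 1 = true} ∩
        ((⋂ i : ℕ+, ⋂ _ : 1 < i, ⋂ _ : i < 1 + m, {y | y i = false}) ∩ {y | y (1 + m) = true}) := by
      ext y
      simp [StringAt]
    rw [h]
    refine (hev _ _ (Set.mem_Iic.2 one_le) _).inter (.inter ?_ (hev _ _ (Set.mem_Iic.2 le_rfl) _))
    exact .iInter fun i => .iInter fun _ => .iInter fun hi => hev _ _ (Set.mem_Iic.2 hi.le) _
  · have hmeas : Measurable[⨆ i ∈ Set.Ioi (1 + m), mc i] (shiftOne m) := by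
      refine @measurable_pi_lambda _ _ _ (_) _ _ fun k => ?_
      by_cases hk : k = 1
      · simp only [shiftOne, hk, if_true]
        exact @measurable_const _ _ _ (_) _
      · simp only [shiftOne, hk, if_false]
        have hk1 : 1 < k := lt_of_le_of_ne one_le (Ne.symm hk)
        have hmem : k + m ∈ Set.Ioi (1 + m) := Set.mem_Ioi.2 (by gcongr)
        exact (Measurable.of_comap_le le_rfl).mono
          (le_iSup₂ (f := fun (i : ℕ+) (_ : i ∈ Set.Ioi (1 + m)) => mc i) (k + m) hmem) le_rfl
    exact hmeas hT

theorem map_shift_restrict {a b : ℝ} (ha : 0 < a) (hb : 0 ≤ b) (m : ℕ+) :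
    ((bernOneLaw a b).restrict {y | StringAt y m 1}).map (shift m) =
      ENNReal.ofReal (secondOneProb a b ((m : ℕ) + 1)) • bernOneLaw a (b + (m : ℝ)) := by
  ext T hT
  rw [Measure.map_apply (measurable_shift m) hT,
    Measure.restrict_apply (measurable_shift m hT), Set.inter_comm,
    bernOneLaw_inter_shift ha hb m hT]
  rfl

theorem bernOneLaw_eq_sum_restrict {a b : ℝ} (ha : 0 < a) (hb : 0 ≤ b) :
    bernOneLaw a b =
      Measure.sum fun m : ℕ+ => (bernOneLaw a b).restrict {y | StringAt y m 1} := by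
  have hdisj : Pairwise (Function.onFun Disjoint fun m : ℕ+ => {y : BinSeq | StringAt y m 1}) := by
    intro m k hmk
    rw [Function.onFun, Set.disjoint_left]
    exact fun y hm hk => hmk (StringAt.unique hm hk)
  have hms := fun m : ℕ+ => measurableSet_stringAt m 1
  rw [← Measure.restrict_iUnion hdisj hms]
  have huniv : bernOneLaw a b (⋃ m : ℕ+, {y : BinSeq | StringAt y m 1}) = 1 := by
    rw [measure_iUnion hdisj hms]
    simp_rw [bernOneLaw_stringAt_one ha hb]
    have hp := hasSum_secondOneProb_pnat ha hb
    rw [← ENNReal.ofReal_tsum_of_nonneg (fun m => secondOneProb_nonneg ha hb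
      (Nat.succ_le_succ m.pos)) hp.summable, hp.tsum_eq, ENNReal.ofReal_one]
  refine (Measure.restrict_eq_self_of_ae_mem ?_).symm
  exact (mem_ae_iff_prob_eq_one (.iUnion hms)).2 huniv

theorem measurable_add_unitVec (n : ℕ) : Measurable fun z : CountVec => z + unitVec n :=
  measurable_pi_lambda _ fun k => (Measurable.of_discrete (f := fun c : ℕ∞ => c + unitVec n k)).comp
    (measurable_pi_apply k)

theorem countLaw_eq_sum_pnat {a b : ℝ} (ha : 0 < a) (hb : 0 ≤ b) :
    countLaw a b = Measure.sum fun m : ℕ+ =>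
      ENNReal.ofReal (secondOneProb a b ((m : ℕ) + 1)) •
        (countLaw a (b + (m : ℝ))).map (fun z => z + unitVec m) := by
  conv_lhs => rw [countLaw, bernOneLaw_eq_sum_restrict ha hb]
  rw [Measure.map_sum measurable_countVector.aemeasurable]
  congr 1
  funext m
  have hae : countVector =ᵐ[(bernOneLaw a b).restrict {y | StringAt y m 1}]
      (fun z => z + unitVec m) ∘ countVector ∘ shift m :=
    (ae_restrict_iff' (measurableSet_stringAt m 1)).2
      (ae_of_all _ fun y hy => countVector_of_stringAt_one hy)
  rw [Measure.map_congr hae, ← Measure.map_map (measurable_add_unitVec m)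
    (measurable_countVector.comp (measurable_shift m)),
    ← Measure.map_map measurable_countVector (measurable_shift m), map_shift_restrict ha hb,
    Measure.map_smul, Measure.map_smul]
  rfl

theorem countLaw_eq_sum {a b : ℝ} (ha : 0 < a) (hb : 0 ≤ b) :
    countLaw a b = Measure.sum fun n : {n : ℕ // 2 ≤ n} =>
      ENNReal.ofReal (secondOneProb a b n) •
        (countLaw a (b + ((n : ℕ) : ℝ) - 1)).map (fun z => z + unitVec ((n : ℕ) - 1)) := by
  rw [countLaw_eq_sum_pnat ha hb]
  ext S hS
  rw [Measure.sum_apply _ hS, Measure.sum_apply _ hS, ← pnatEquivTwoLe.tsum_eq]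
  refine tsum_congr fun m => ?_
  have h : b + (((m : ℕ) + 1 : ℕ) : ℝ) - 1 = b + (m : ℝ) := by push_cast; ring
  have hm : ((pnatEquivTwoLe m : {n : ℕ // 2 ≤ n}) : ℕ) = (m : ℕ) + 1 := rfl
  rw [hm, h, Nat.add_sub_cancel]

/-- The chance that a `d`-string occurs at all is of order `1 / b`. -/
theorem countLaw_ne_zero_le {a b : ℝ} (ha : 0 < a) (hb : 0 ≤ b) (d : ℕ+) :
    countLaw a b {z | z d ≠ 0} ≤ ENNReal.ofReal (a * (a + 1) / (a + b)) := by
  have hpos : ∀ j : ℕ, 0 < a + b + j := fun j => by positivity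
  -- Only the two end entries of the string are kept. With `n = j + 1` the right end is at time at
  -- least `j + 2`, which gives the factor `a/(a+b+j)`.
  have hstep : ∀ j : ℕ, bernOneLaw a b {y | StringAt y d j.succPNat} ≤
      ENNReal.ofReal (bernOneProb a b j.succPNat * (a / (a + b + j))) := by
    intro j
    set n := j.succPNat with hn
    have hsub : {y : BinSeq | StringAt y d n} ⊆
        Set.pi (↑({n, n + d} : Finset ℕ+) : Set ℕ+) fun _ => {true} := by
      intro y hy i hi
      simp only [Finset.coe_insert, Finset.coe_singleton, Set.mem_insert_iff,
        Set.mem_singleton_iff] at hi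
      rcases hi with rfl | rfl
      · exact hy.1
      · exact hy.2.2
    refine (measure_mono hsub).trans ?_
    rw [bernOneLaw_eq, Measure.infinitePi_pi _ (fun _ _ => .of_discrete),
      Finset.prod_pair (PNat.lt_add_right n d).ne, bernOneMarginal_true ha hb,
      bernOneMarginal_true ha hb, ← ENNReal.ofReal_mul (bernOneProb_mem ha hb n).1]
    refine ENNReal.ofReal_le_ofReal (mul_le_mul_of_nonneg_left ?_ (bernOneProb_mem ha hb n).1)
    rw [bernOneProb_of_ne_one _ _ (add_ne_one n d)]
    refine div_le_div_of_nonneg_left ha.le (hpos j) ?_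
    have hd : (1 : ℝ) ≤ (d : ℝ) := by exact_mod_cast (one_le (a := d))
    rw [PNat.add_coe, hn, Nat.succPNat_coe]
    push_cast
    linarith
  have hsum : ∀ N : ℕ, ∑ j ∈ Finset.range N,
      bernOneProb a b j.succPNat * (a / (a + b + j)) ≤ a * (a + 1) / (a + b) := by
    -- The term `j = 0` is `a/(a+b)`; for `j ≥ 1` the term is `a²` times `1/(a+b+j-1) - 1/(a+b+j)`,
    -- so the sum telescopes.
    have hEq : ∀ N : ℕ, ∑ j ∈ Finset.range (N + 1),
        bernOneProb a b j.succPNat * (a / (a + b + j)) =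
          a * (a + 1) / (a + b) - a ^ 2 / (a + b + N) := by
      intro N
      induction N with
      | zero =>
        have : Nat.succPNat 0 = 1 := rfl
        have h0 : a + b ≠ 0 := by positivity
        simp only [zero_add, Finset.sum_range_one, this, bernOneProb_one, Nat.cast_zero, add_zero]
        field_simp
        ring
      | succ N ih =>
        have hne : (N + 1).succPNat ≠ 1 := by
          intro h
          have := congrArg PNat.val h
          simp at this
        rw [Finset.sum_range_succ, ih, bernOneProb_of_ne_one _ _ hne, Nat.succPNat_coe]
        have h1 : a + b + ((Nat.succ (N + 1) : ℕ) : ℝ) - 2 = a + b + N := by push_cast; ring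
        have h2 := (hpos N).ne'
        have h3 := (hpos (N + 1)).ne'
        have h4 : a + b ≠ 0 := by positivity
        rw [h1]
        push_cast at h3 ⊢
        field_simp
        ring
    intro N
    cases N with
    | zero => simp; positivity
    | succ N =>
      rw [hEq]
      have : 0 ≤ a ^ 2 / (a + b + N) := by positivity
      linarith
  have hnn : ∀ j : ℕ, 0 ≤ bernOneProb a b j.succPNat * (a / (a + b + j)) := fun j =>
    mul_nonneg (bernOneProb_mem ha hb _).1 (div_nonneg ha.le (hpos j).le)
  have hms : MeasurableSet {z : CountVec | z d ≠ 0} :=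
    measurable_pi_apply (X := fun _ : ℕ+ => ℕ∞) d (MeasurableSet.of_discrete (s := {c | c ≠ 0}))
  rw [countLaw, Measure.map_apply measurable_countVector hms]
  have hpre : countVector ⁻¹' {z | z d ≠ 0} ⊆ ⋃ j : ℕ, {y : BinSeq | StringAt y d j.succPNat} := by
    intro y hy
    have hne : {n : ℕ+ | StringAt y d n} ≠ ∅ := by
      rw [← Set.encard_ne_zero.trans Set.nonempty_iff_ne_empty]
      exact hy
    obtain ⟨n, hn⟩ := Set.nonempty_iff_ne_empty.2 hne
    refine Set.mem_iUnion.2 ⟨n.natPred, ?_⟩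
    simpa [PNat.succPNat_natPred] using hn
  refine (measure_mono hpre).trans ((measure_iUnion_le _).trans ?_)
  refine (ENNReal.tsum_le_tsum hstep).trans ?_
  rw [ENNReal.tsum_eq_iSup_nat]
  refine iSup_le fun N => ?_
  rw [← ENNReal.ofReal_sum_of_nonneg fun j _ => hnn j]
  exact ENNReal.ofReal_le_ofReal (hsum N)

end Decomposition

/-! ### Derivatives of Poisson cylinder probabilities -/

section PoissonWeights

/-- The Poisson weight `e^{-l} l^j / j!`, extended by `0` to negative integers `j`. -/
noncomputable def poissonWeight (l : ℝ) (j : ℤ) : ℝ :=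
  if 0 ≤ j then Real.exp (-l) * l ^ j.toNat / (j.toNat.factorial : ℝ) else 0

theorem poissonWeight_natCast (l : ℝ) (n : ℕ) :
    poissonWeight l n = Real.exp (-l) * l ^ n / (n.factorial : ℝ) := by
  simp [poissonWeight]

theorem poissonWeight_of_neg (l : ℝ) {j : ℤ} (hj : j < 0) : poissonWeight l j = 0 := by
  simp [poissonWeight, hj]

theorem poissonWeight_nonneg {l : ℝ} (hl : 0 ≤ l) (j : ℤ) : 0 ≤ poissonWeight l j := by
  unfold poissonWeight
  split_ifs <;> positivity

/-- Differentiation in the mean acts as a backward difference in `j`; the value 0 at negative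
integers makes this hold at `j = 0` too. -/
theorem hasDerivAt_poissonWeight (l : ℝ) (j : ℤ) :
    HasDerivAt (fun l => poissonWeight l j) (poissonWeight l (j - 1) - poissonWeight l j) l := by
  have hexp : HasDerivAt (fun l : ℝ => Real.exp (-l)) (-Real.exp (-l)) l := by
    simpa using (hasDerivAt_neg l).exp
  rcases lt_or_ge j 0 with hj | hj
  · simp only [poissonWeight_of_neg _ hj, poissonWeight_of_neg _ (show j - 1 < 0 by omega)]
    simpa using hasDerivAt_const l (0 : ℝ)
  · obtain ⟨n, rfl⟩ := Int.eq_ofNat_of_zero_le hj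
    cases n with
    | zero =>
      have h0 : ∀ l, poissonWeight l ((0 : ℕ) : ℤ) = Real.exp (-l) := fun l => by
        simp [poissonWeight]
      rw [poissonWeight_of_neg _ (by simp)]
      simp only [h0]
      simpa using hexp
    | succ n =>
      have h1 : (((n + 1 : ℕ) : ℤ) - 1) = (n : ℕ) := by push_cast; ring
      rw [h1]
      simp only [poissonWeight_natCast]
      convert! (hexp.mul (hasDerivAt_pow (n + 1) l)).div_const ((n + 1).factorial : ℝ) using 1
      have : ((n.factorial : ℕ) : ℝ) ≠ 0 := by exact_mod_cast n.factorial_ne_zero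
      rw [Nat.factorial_succ]
      push_cast
      field_simp
      ring

/-- The mean `a (1 - x ^ k) / k` of the `k`-th Poisson count. -/
noncomputable def poissonRate (a : ℝ) (k : ℕ+) (x : ℝ) : ℝ := a * (1 - x ^ (k : ℕ)) / (k : ℝ)

theorem poissonRate_nonneg {a x : ℝ} (ha : 0 < a) (hx : x ∈ Set.Icc (0 : ℝ) 1) (k : ℕ+) :
    0 ≤ poissonRate a k x :=
  div_nonneg (mul_nonneg ha.le (sub_nonneg.2 (pow_le_one₀ hx.1 hx.2))) (Nat.cast_nonneg _)

theorem poissonRate_le {a x : ℝ} (ha : 0 < a) (hx : x ∈ Set.Icc (0 : ℝ) 1) (k : ℕ+) :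
    poissonRate a k x ≤ a * (1 - x) := by
  have hk : (0 : ℝ) < (k : ℝ) := by exact_mod_cast k.pos
  -- Bernoulli's inequality in the form `1 - x ^ k ≤ k (1 - x)`; the factor `k` cancels the
  -- denominator, so the bound is uniform in `k`.
  have hB := one_add_mul_le_pow (a := x - 1) (by linarith [hx.1]) (k : ℕ)
  rw [add_sub_cancel] at hB
  rw [poissonRate, div_le_iff₀ hk, mul_assoc]
  exact mul_le_mul_of_nonneg_left (by linarith) ha.le

theorem hasDerivAt_poissonRate (a : ℝ) (k : ℕ+) (x : ℝ) :
    HasDerivAt (poissonRate a k) (-(a * x ^ ((k : ℕ) - 1))) x := by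
  have hk : (k : ℝ) ≠ 0 := by exact_mod_cast k.ne_zero
  convert! (((hasDerivAt_pow (k : ℕ) x).const_sub 1).const_mul a).div_const (k : ℝ) using 1
  field_simp

/-- The probability that independent Poisson counts of means `poissonRate a k x` take the values
`z k` for `k ∈ I`. -/
noncomputable def poissonCylinderProb (a : ℝ) (I : Finset ℕ+) (z : ℕ+ → ℤ) (x : ℝ) : ℝ :=
  ∏ k ∈ I, poissonWeight (poissonRate a k x) (z k)

theorem poissonCylinderProb_nonneg {a x : ℝ} (ha : 0 < a) (hx : x ∈ Set.Icc (0 : ℝ) 1)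
    (I : Finset ℕ+) (z : ℕ+ → ℤ) : 0 ≤ poissonCylinderProb a I z x :=
  Finset.prod_nonneg fun k _ => poissonWeight_nonneg (poissonRate_nonneg ha hx k) _

theorem poissonCylinderProb_sub_single_of_notMem (a x : ℝ) {I : Finset ℕ+} (z : ℕ+ → ℤ) {m : ℕ+}
    (hm : m ∉ I) :
    poissonCylinderProb a I (z - Pi.single m 1) x = poissonCylinderProb a I z x := by
  refine Finset.prod_congr rfl fun k hk => ?_
  have : k ≠ m := fun h => hm (h ▸ hk)
  simp [this]

theorem hasDerivAt_poissonCylinderProb (a : ℝ) (I : Finset ℕ+) (z : ℕ+ → ℤ) (x : ℝ) :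
    HasDerivAt (poissonCylinderProb a I z)
      (∑ k ∈ I, -(a * x ^ ((k : ℕ) - 1)) *
        (poissonCylinderProb a I (z - Pi.single k 1) x - poissonCylinderProb a I z x)) x := by
  have h := HasDerivAt.fun_finsetProd (u := I) (x := x)
    (f := fun k x => poissonWeight (poissonRate a k x) (z k))
    (f' := fun k => (poissonWeight (poissonRate a k x) (z k - 1) -
      poissonWeight (poissonRate a k x) (z k)) * -(a * x ^ ((k : ℕ) - 1)))
    (fun k _ => (hasDerivAt_poissonWeight _ (z k)).comp x (hasDerivAt_poissonRate a k x))
  convert! h using 1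
  refine Finset.sum_congr rfl fun k hk => ?_
  have h1 : poissonCylinderProb a I (z - Pi.single k 1) x =
      (∏ j ∈ I.erase k, poissonWeight (poissonRate a j x) (z j)) *
        poissonWeight (poissonRate a k x) (z k - 1) := by
    rw [poissonCylinderProb, ← Finset.prod_erase_mul _ _ hk]
    congr 1
    · refine Finset.prod_congr rfl fun j hj => ?_
      simp [Finset.ne_of_mem_erase hj]
    · simp
  have h2 : poissonCylinderProb a I z x =
      (∏ j ∈ I.erase k, poissonWeight (poissonRate a j x) (z j)) *
        poissonWeight (poissonRate a k x) (z k) := by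
    rw [poissonCylinderProb, ← Finset.prod_erase_mul _ _ hk]
  rw [h1, h2, smul_eq_mul]
  ring

theorem continuous_poissonCylinderProb (a : ℝ) (I : Finset ℕ+) (z : ℕ+ → ℤ) :
    Continuous (poissonCylinderProb a I z) :=
  continuous_iff_continuousAt.2 fun x => (hasDerivAt_poissonCylinderProb a I z x).continuousAt

/-- Lowering a coordinate outside `I` changes nothing, so the series is a geometric series plus
finitely many corrections, the same ones that appear in the derivative of the cylinder probability.
-/
theorem hasSum_pow_mul_poissonCylinderProb (a : ℝ) (I : Finset ℕ+) (z : ℕ+ → ℤ) {x : ℝ}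
    (hx : x ∈ Set.Ioo (0 : ℝ) 1) :
    HasSum (fun m : ℕ+ => x ^ (m : ℕ) * poissonCylinderProb a I (z - Pi.single m 1) x)
      (x / (1 - x) * poissonCylinderProb a I z x + ∑ k ∈ I, x ^ (k : ℕ) *
        (poissonCylinderProb a I (z - Pi.single k 1) x - poissonCylinderProb a I z x)) := by
  have hgeo : HasSum (fun m : ℕ+ => x ^ (m : ℕ)) (x / (1 - x)) := by
    rw [← Equiv.pnatEquivNat.symm.hasSum_iff]
    convert! (hasSum_geometric_of_lt_one hx.1.le hx.2).mul_left x using 1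
    funext n
    simp [pow_succ']
  have hfin : HasSum (fun m : ℕ+ => x ^ (m : ℕ) *
      (poissonCylinderProb a I (z - Pi.single m 1) x - poissonCylinderProb a I z x))
      (∑ m ∈ I, x ^ (m : ℕ) *
        (poissonCylinderProb a I (z - Pi.single m 1) x - poissonCylinderProb a I z x)) :=
    hasSum_sum_of_ne_finset_zero (fun m hm => by rw [poissonCylinderProb_sub_single_of_notMem a x z hm]; ring)
  convert! (hgeo.mul_right (poissonCylinderProb a I z x)).add hfin using 1
  funext m
  ring

end PoissonWeights

/-! ### The recursion for Beta mixtures -/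

section BetaIntegrals

theorem integrableOn_rpow_mul_one_sub_rpow {c d : ℝ} (hc : 0 < c) (hd : 0 < d) :
    IntegrableOn (fun x : ℝ => x ^ (c - 1) * (1 - x) ^ (d - 1)) (Set.Ioo 0 1) := by
  have hb := beta_pos hc hd
  have hfin : ∫⁻ x in Set.Ioo (0 : ℝ) 1,
      ENNReal.ofReal (1 / beta c d * x ^ (c - 1) * (1 - x) ^ (d - 1)) ≠ ∞ := by
    rw [← lintegral_betaPDF, lintegral_betaPDF_eq_one hc hd]
    exact ENNReal.one_ne_top
  have hi : IntegrableOn (fun x : ℝ => 1 / beta c d * x ^ (c - 1) * (1 - x) ^ (d - 1))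
      (Set.Ioo 0 1) := by
    refine (lintegral_ofReal_ne_top_iff_integrable
      (Measurable.aestronglyMeasurable (by fun_prop)) ?_).1 hfin
    refine ae_restrict_of_forall_mem measurableSet_Ioo fun x hx => ?_
    have := Real.rpow_nonneg hx.1.le (c - 1)
    have := Real.rpow_nonneg (sub_nonneg.2 hx.2.le) (d - 1)
    change 0 ≤ 1 / beta c d * x ^ (c - 1) * (1 - x) ^ (d - 1)
    positivity
  refine (hi.const_mul (beta c d)).congr (ae_of_all _ fun x => ?_)
  field_simp

theorem integrableOn_rpow_mul_one_sub_rpow_mul {c d : ℝ} (hc : 0 < c) (hd : 0 < d) {g : ℝ → ℝ}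
    (hg : Continuous g) :
    IntegrableOn (fun x : ℝ => x ^ (c - 1) * (1 - x) ^ (d - 1) * g x) (Set.Ioo 0 1) := by
  have h := (integrableOn_Icc_iff_integrableOn_Ioo enorm_ne_top enorm_ne_top).2
    (integrableOn_rpow_mul_one_sub_rpow hc hd)
  exact (integrableOn_Icc_iff_integrableOn_Ioo enorm_ne_top enorm_ne_top).1
    (h.mul_continuousOn hg.continuousOn isCompact_Icc)

/-- The unnormalized `Beta(c, a + 1)` mixture of the Poisson cylinder probabilities. -/
noncomputable def betaPoissonIntegral (a : ℝ) (I : Finset ℕ+) (c : ℝ) (z : ℕ+ → ℤ) : ℝ :=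
  ∫ x in Set.Ioo (0 : ℝ) 1, x ^ (c - 1) * (1 - x) ^ a * poissonCylinderProb a I z x

/-- Integration by parts against `x ^ c * (1 - x) ^ a`, which vanishes at both ends because `c` and
`a` are positive, followed by termwise integration of a series. -/
theorem hasSum_betaPoissonIntegral {a c : ℝ} (ha : 0 < a) (hc : 0 < c) (I : Finset ℕ+)
    (z : ℕ+ → ℤ) :
    HasSum (fun m : ℕ+ => a * betaPoissonIntegral a I (c + (m : ℝ)) (z - Pi.single m 1))
      (c * betaPoissonIntegral a I c z) := by
  set q := poissonCylinderProb a I z with hq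
  set q' : ℝ → ℝ := fun x => ∑ k ∈ I, -(a * x ^ ((k : ℕ) - 1)) *
    (poissonCylinderProb a I (z - Pi.single k 1) x - poissonCylinderProb a I z x) with hq'
  have hqc : Continuous q := continuous_poissonCylinderProb a I z
  have hqc' : Continuous q' := by
    refine continuous_finsetSum _ fun k _ => ?_
    exact (continuous_const.mul (continuous_pow _)).neg.mul
      ((continuous_poissonCylinderProb _ _ _).sub (continuous_poissonCylinderProb _ _ _))
  -- The derivative of `x ^ c * (1 - x) ^ a * q x`, so its integral over `(0,1)` is zero.
  set D : ℝ → ℝ := fun x => c * (x ^ (c - 1) * (1 - x) ^ a * q x) -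
    a * (x ^ c * (1 - x) ^ (a - 1) * q x) + x ^ c * (1 - x) ^ a * q' x with hD
  have hint0 : IntegrableOn (fun x : ℝ => x ^ (c - 1) * (1 - x) ^ a * q x) (Set.Ioo 0 1) := by
    simpa using integrableOn_rpow_mul_one_sub_rpow_mul hc (show 0 < a + 1 by linarith) hqc
  have hint1 : IntegrableOn (fun x : ℝ => x ^ c * (1 - x) ^ (a - 1) * q x) (Set.Ioo 0 1) := by
    simpa using integrableOn_rpow_mul_one_sub_rpow_mul (show 0 < c + 1 by linarith) ha hqc
  have hint2 : IntegrableOn (fun x : ℝ => x ^ c * (1 - x) ^ a * q' x) (Set.Ioo 0 1) := by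
    simpa using integrableOn_rpow_mul_one_sub_rpow_mul (show 0 < c + 1 by linarith)
      (show 0 < a + 1 by linarith) hqc'
  have hintD : IntegrableOn D (Set.Ioo 0 1) := ((hint0.const_mul c).sub (hint1.const_mul a)).add hint2
  have hFTC : ∫ x in Set.Ioo (0 : ℝ) 1, D x = 0 := by
    have h := intervalIntegral.integral_eq_sub_of_hasDerivAt_of_le (a := 0) (b := 1)
      (f := fun x : ℝ => x ^ c * (1 - x) ^ a * q x) (f' := D) zero_le_one ?_ ?_
      ((intervalIntegrable_iff_integrableOn_Ioo_of_le zero_le_one).2 hintD)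
    · rw [intervalIntegral.integral_of_le zero_le_one, integral_Ioc_eq_integral_Ioo] at h
      rw [h]
      simp [Real.zero_rpow hc.ne', Real.zero_rpow ha.ne']
    · refine Continuous.continuousOn ?_
      exact ((Real.continuous_rpow_const hc.le).mul
        ((Real.continuous_rpow_const ha.le).comp (continuous_const.sub continuous_id))).mul hqc
    · intro x hx
      have h1 := Real.hasDerivAt_rpow_const (x := x) (p := c) (Or.inl hx.1.ne')
      have h2 : HasDerivAt (fun x : ℝ => (1 - x) ^ a) (-(a * (1 - x) ^ (a - 1))) x := by
        have := (Real.hasDerivAt_rpow_const (x := 1 - x) (p := a)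
          (Or.inl (sub_pos.2 hx.2).ne')).comp x ((hasDerivAt_id x).const_sub 1)
        simpa [Function.comp_def] using this
      convert! (h1.mul h2).mul (hasDerivAt_poissonCylinderProb a I z x) using 1
      simp only [hD, hq', ← hq, Pi.mul_apply]
      ring
  have hcJ : c * betaPoissonIntegral a I c z =
      ∫ x in Set.Ioo (0 : ℝ) 1, (c * (x ^ (c - 1) * (1 - x) ^ a * q x) - D x) := by
    rw [integral_sub (hint0.const_mul c) hintD, hFTC, sub_zero, integral_const_mul]
    rfl
  -- Subtracting `D` leaves `a x^c (1-x)^(a-1) q - x^c (1-x)^a q'`. This is `a x^(c-1) (1-x)^a`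
  -- times the geometric sum plus corrections.
  have hpt : ∀ x ∈ Set.Ioo (0 : ℝ) 1, HasSum (fun m : ℕ+ =>
      a * (x ^ (c + (m : ℝ) - 1) * (1 - x) ^ a * poissonCylinderProb a I (z - Pi.single m 1) x))
      (c * (x ^ (c - 1) * (1 - x) ^ a * q x) - D x) := by
    intro x hx
    have hx1 : 0 < 1 - x := sub_pos.2 hx.2
    convert! (hasSum_pow_mul_poissonCylinderProb a I z hx).mul_left
      (a * x ^ (c - 1) * (1 - x) ^ a) using 1
    · funext m
      have : x ^ (c + (m : ℝ) - 1) = x ^ (c - 1) * x ^ (m : ℕ) := by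
        rw [← Real.rpow_natCast x m, ← Real.rpow_add hx.1]
        ring_nf
      rw [this]
      ring
    · have hxc : x ^ c = x ^ (c - 1) * x := by
        rw [← Real.rpow_add_one hx.1.ne', sub_add_cancel]
      have hxa : (1 - x) ^ a = (1 - x) ^ (a - 1) * (1 - x) := by
        rw [← Real.rpow_add_one hx1.ne', sub_add_cancel]
      have hs : x * q' x = -(a * ∑ k ∈ I, x ^ (k : ℕ) *
          (poissonCylinderProb a I (z - Pi.single k 1) x - poissonCylinderProb a I z x)) := by
        rw [hq', Finset.mul_sum, Finset.mul_sum, ← Finset.sum_neg_distrib]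
        refine Finset.sum_congr rfl fun k _ => ?_
        rw [← mul_pow_sub_one k.ne_zero x]
        ring
      have hD' : D x = c * (x ^ (c - 1) * (1 - x) ^ a * q x) -
          a * (x ^ (c - 1) * x * (1 - x) ^ (a - 1) * q x) +
            x ^ (c - 1) * (1 - x) ^ a * (x * q' x) := by
        simp only [hD]
        rw [hxc]
        ring
      rw [hD', hs, hxa]
      field_simp
      ring
  rw [hcJ]
  have hF : ∀ m : ℕ+, IntegrableOn (fun x : ℝ =>
      a * (x ^ (c + (m : ℝ) - 1) * (1 - x) ^ a * poissonCylinderProb a I (z - Pi.single m 1) x))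
      (Set.Ioo 0 1) := by
    intro m
    have hm : (0 : ℝ) < (m : ℝ) := by exact_mod_cast m.pos
    have := integrableOn_rpow_mul_one_sub_rpow_mul (show 0 < c + (m : ℝ) by linarith)
      (show 0 < a + 1 by linarith) (continuous_poissonCylinderProb a I (z - Pi.single m 1))
    rw [add_sub_cancel_right] at this
    exact this.const_mul a
  -- The terms are nonnegative, so each serves as its own bound, and the sum of the bounds is the
  -- integrable limit.
  have hmain := hasSum_integral_of_dominated_convergence (μ := volume.restrict (Set.Ioo (0 : ℝ) 1))
    (F := fun (m : ℕ+) (x : ℝ) =>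
      a * (x ^ (c + (m : ℝ) - 1) * (1 - x) ^ a * poissonCylinderProb a I (z - Pi.single m 1) x))
    (f := fun x => c * (x ^ (c - 1) * (1 - x) ^ a * q x) - D x)
    (fun (m : ℕ+) (x : ℝ) =>
      a * (x ^ (c + (m : ℝ) - 1) * (1 - x) ^ a * poissonCylinderProb a I (z - Pi.single m 1) x))
    (fun m => (hF m).aestronglyMeasurable) ?_ ?_ ?_ ?_
  · simp only [integral_const_mul] at hmain
    exact hmain
  · intro m
    refine ae_restrict_of_forall_mem measurableSet_Ioo fun x hx => ?_
    rw [Real.norm_of_nonneg]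
    have h1 := Real.rpow_nonneg hx.1.le (c + (m : ℝ) - 1)
    have h2 := Real.rpow_nonneg (sub_nonneg.2 hx.2.le) a
    have h3 := poissonCylinderProb_nonneg ha ⟨hx.1.le, hx.2.le⟩ I (z - Pi.single m 1)
    positivity
  · exact ae_restrict_of_forall_mem measurableSet_Ioo fun x hx => (hpt x hx).summable
  · refine ((hint0.const_mul c).sub hintD).congr ?_
    exact ae_restrict_of_forall_mem measurableSet_Ioo fun x hx => (hpt x hx).tsum_eq.symm
  · exact ae_restrict_of_forall_mem measurableSet_Ioo hpt

theorem beta_add_one_left {u v : ℝ} (hu : 0 < u) (hv : 0 < v) :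
    beta (u + 1) v = beta u v * (u / (u + v)) := by
  have h1 : u + 1 + v = u + v + 1 := by ring
  have h2 : u + v ≠ 0 := by positivity
  have h3 := (Real.Gamma_pos_of_pos (add_pos hu hv)).ne'
  rw [beta, beta, h1, Real.Gamma_add_one hu.ne', Real.Gamma_add_one h2]
  field_simp

theorem beta_add_one_right {u v : ℝ} (hu : 0 < u) (hv : 0 < v) :
    beta u (v + 1) = beta u v * (v / (u + v)) := by
  have h1 : u + (v + 1) = u + v + 1 := by ring
  have h2 : u + v ≠ 0 := by positivity
  have h3 := (Real.Gamma_pos_of_pos (add_pos hu hv)).ne'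
  rw [beta, beta, h1, Real.Gamma_add_one hv.ne', Real.Gamma_add_one h2]
  field_simp

/-- This is what makes the normalized Beta mixtures obey the recursion with the weights `p`. Raising
`m` by 1 multiplies both sides by the same ratio, by `beta_add_one_left`. -/
theorem secondOneProb_eq_beta_ratio {a c : ℝ} (ha : 0 < a) (hc : 0 < c) (m : ℕ+) :
    secondOneProb a (c + 1) ((m : ℕ) + 1) =
      a / c * (beta (c + (m : ℝ)) (a + 1) / beta c (a + 1)) := by
  have ha1 : 0 < a + 1 := by linarith
  have hb := (beta_pos hc ha1).ne'
  suffices h : ∀ j : ℕ, secondOneProb a (c + 1) (j + 2) =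
      a / c * (beta (c + j + 1) (a + 1) / beta c (a + 1)) by
    obtain ⟨j, rfl⟩ : ∃ j : ℕ, m = j.succPNat := ⟨m.natPred, (PNat.succPNat_natPred m).symm⟩
    rw [Nat.succPNat_coe, h j]
    push_cast
    rw [add_assoc]
  intro j
  induction j with
  | zero =>
    have h1 : c + ((0 : ℕ) : ℝ) + 1 = c + 1 := by simp
    rw [h1, beta_add_one_left hc ha1, secondOneProb]
    simp only [zero_add, Nat.sub_self, Finset.range_zero, Finset.prod_empty, mul_one]
    have h2 : c + (a + 1) ≠ 0 := by positivity
    have h3 : a + (c + 1) + ((2 : ℕ) : ℝ) - 2 = c + (a + 1) := by push_cast; ring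
    rw [h3]
    field_simp
  | succ j ih =>
    have h1 : c + ((j + 1 : ℕ) : ℝ) + 1 = c + j + 1 + 1 := by push_cast; ring
    have hpos : 0 < c + j + 1 := by positivity
    rw [h1, beta_add_one_left hpos ha1]
    have h4 : a / c * (beta (c + j + 1) (a + 1) * ((c + j + 1) / (c + j + 1 + (a + 1))) /
        beta c (a + 1)) = secondOneProb a (c + 1) (j + 2) *
          ((c + j + 1) / (c + j + 1 + (a + 1))) := by
      rw [ih]
      ring
    rw [h4, secondOneProb, secondOneProb, Nat.add_sub_cancel, Nat.add_sub_cancel,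
      Finset.prod_range_succ]
    have h5 : a + (c + 1) + ((j + 1 + 2 : ℕ) : ℝ) - 2 = c + j + 1 + (a + 1) := by push_cast; ring
    have h6 : a + (c + 1) + ((j + 2 : ℕ) : ℝ) - 2 = a + (c + 1) + j := by push_cast; ring
    rw [h5, h6]
    have h7 : a + (c + 1) + (j : ℝ) ≠ 0 := by positivity
    have h8 : c + j + 1 + (a + 1) ≠ 0 := by positivity
    field_simp
    ring

theorem hasSum_betaPoisson {a c : ℝ} (ha : 0 < a) (hc : 0 < c) (I : Finset ℕ+) (z : ℕ+ → ℤ) :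
    HasSum (fun m : ℕ+ => secondOneProb a (c + 1) ((m : ℕ) + 1) *
      (betaPoissonIntegral a I (c + (m : ℝ)) (z - Pi.single m 1) / beta (c + (m : ℝ)) (a + 1)))
      (betaPoissonIntegral a I c z / beta c (a + 1)) := by
  have ha1 : 0 < a + 1 := by linarith
  have hb := (beta_pos hc ha1).ne'
  convert! (hasSum_betaPoissonIntegral ha hc I z).mul_left (1 / (c * beta c (a + 1))) using 1
  · funext m
    have hm : (0 : ℝ) < (m : ℝ) := by exact_mod_cast m.pos
    have hbm := (beta_pos (show 0 < c + (m : ℝ) by linarith) ha1).ne'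
    rw [secondOneProb_eq_beta_ratio ha hc]
    field_simp
  · field_simp

end BetaIntegrals

/-! ### The Beta mixture of Poisson products -/

section Mixture

/-- The law of the `k`-th coordinate of `poissonProduct a x`. -/
noncomputable def poissonMarginal (a x : ℝ) (k : ℕ+) : Measure ℕ∞ :=
  (poissonMeasure (Real.toNNReal (a * (1 - x ^ (k : ℕ)) / (k : ℝ)))).map (Nat.cast : ℕ → ℕ∞)

instance (a x : ℝ) (k : ℕ+) : IsProbabilityMeasure (poissonMarginal a x k) := by
  unfold poissonMarginal; infer_instance

theorem poissonProduct_eq (a x : ℝ) :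
    poissonProduct a x = Measure.infinitePi (poissonMarginal a x) := rfl

instance (a x : ℝ) : IsProbabilityMeasure (poissonProduct a x) := by
  rw [poissonProduct_eq]; infer_instance

theorem measurable_poissonMarginal (a : ℝ) (k : ℕ+) (s : Set ℕ∞) :
    Measurable fun x => poissonMarginal a x k s := by
  have h : ∀ x, poissonMarginal a x k s = ∑' n : ℕ,
      ENNReal.ofReal (Real.exp (-(Real.toNNReal (a * (1 - x ^ (k : ℕ)) / (k : ℝ)) : ℝ≥0)) *
        (Real.toNNReal (a * (1 - x ^ (k : ℕ)) / (k : ℝ)) : ℝ≥0) ^ n / (n.factorial : ℝ)) *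
          Measure.dirac n ((Nat.cast : ℕ → ℕ∞) ⁻¹' s) := by
    intro x
    rw [poissonMarginal, Measure.map_apply .of_discrete .of_discrete, poissonMeasure,
      Measure.sum_apply _ .of_discrete]
    rfl
  simp_rw [h]
  fun_prop

theorem measurable_poissonProduct (a : ℝ) : Measurable (poissonProduct a) := by
  refine Measurable.measure_of_isPiSystem_of_isProbabilityMeasure
    (generateFrom_squareCylinders (α := fun _ : ℕ+ => ℕ∞)).symm
    (isPiSystem_squareCylinders (fun _ => MeasurableSpace.isPiSystem_measurableSet)
      fun _ => by simp) ?_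
  rintro _ ⟨s, t, -, rfl⟩
  simp_rw [poissonProduct_eq, Measure.infinitePi_pi _ (fun _ _ => .of_discrete)]
  exact Finset.measurable_fun_prod _ fun k _ => measurable_poissonMarginal a k (t k)

/-- The values `c` equal to the integer `j`. -/
def valueSet (j : ℤ) : Set ℕ∞ := {c | ∃ n : ℕ, (n : ℕ∞) = c ∧ (n : ℤ) = j}

/-- The count vectors whose coordinates in `I` are given by `z`. -/
def countCylinder (I : Finset ℕ+) (z : ℕ+ → ℤ) : Set CountVec :=
  Set.pi (I : Set ℕ+) fun k => valueSet (z k)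

theorem measurableSet_countCylinder (I : Finset ℕ+) (z : ℕ+ → ℤ) :
    MeasurableSet (countCylinder I z) :=
  MeasurableSet.pi I.countable_toSet fun _ _ => .of_discrete

theorem valueSet_natCast (n : ℕ) : valueSet (n : ℤ) = {(n : ℕ∞)} := by
  ext c
  simp only [valueSet, Set.mem_ofPred_eq, Nat.cast_inj, Set.mem_singleton_iff]
  constructor
  · rintro ⟨_, rfl, rfl⟩; rfl
  · rintro rfl; exact ⟨n, rfl, rfl⟩

theorem valueSet_of_neg {j : ℤ} (hj : j < 0) : valueSet j = ∅ := by
  ext c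
  simp only [valueSet, Set.mem_ofPred_eq, Set.mem_empty_iff_false, iff_false]
  rintro ⟨n, -, rfl⟩
  omega

theorem add_one_mem_valueSet {c : ℕ∞} {j : ℤ} : c + 1 ∈ valueSet j ↔ c ∈ valueSet (j - 1) := by
  constructor
  · rintro ⟨n, hn, rfl⟩
    cases n with
    | zero => exact absurd hn.symm (by simp)
    | succ n =>
      refine ⟨n, ?_, by simp⟩
      push_cast at hn
      exact (WithTop.add_right_cancel ENat.one_ne_top hn)
  · rintro ⟨n, rfl, hn⟩
    exact ⟨n + 1, by simp, by push_cast; omega⟩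

/-- Integer entries allow `z - e_m` without truncation: a negative entry in `I` yields the empty
cylinder, as it must. -/
theorem preimage_add_unitVec_countCylinder (I : Finset ℕ+) (z : ℕ+ → ℤ) (m : ℕ+) :
    (fun w : CountVec => w + unitVec m) ⁻¹' countCylinder I z =
      countCylinder I (z - Pi.single m 1) := by
  ext w
  simp only [countCylinder, Set.mem_preimage, Set.mem_pi]
  refine forall₂_congr fun k _ => ?_
  by_cases hk : k = m
  · subst hk
    simp [unitVec, add_one_mem_valueSet]
  · have : ¬ ((k : ℕ) = m) := fun h => hk (PNat.eq h)
    simp [unitVec, hk, this]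

theorem poissonMarginal_valueSet {a x : ℝ} (ha : 0 < a) (hx : x ∈ Set.Icc (0 : ℝ) 1) (k : ℕ+)
    (j : ℤ) :
    poissonMarginal a x k (valueSet j) = ENNReal.ofReal (poissonWeight (poissonRate a k x) j) := by
  rcases lt_or_ge j 0 with hj | hj
  · rw [valueSet_of_neg hj, poissonWeight_of_neg _ hj]
    simp
  · obtain ⟨n, rfl⟩ := Int.eq_ofNat_of_zero_le hj
    have hpre : (Nat.cast : ℕ → ℕ∞) ⁻¹' {(n : ℕ∞)} = {n} := by ext; simp
    rw [valueSet_natCast, poissonMarginal, Measure.map_apply .of_discrete .of_discrete, hpre,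
      poissonMeasure_singleton, ← poissonRate, Real.coe_toNNReal _ (poissonRate_nonneg ha hx k),
      poissonWeight_natCast]

theorem poissonProduct_countCylinder {a x : ℝ} (ha : 0 < a) (hx : x ∈ Set.Icc (0 : ℝ) 1)
    (I : Finset ℕ+) (z : ℕ+ → ℤ) :
    poissonProduct a x (countCylinder I z) = ENNReal.ofReal (poissonCylinderProb a I z x) := by
  rw [poissonProduct_eq, countCylinder, Measure.infinitePi_pi _ (fun _ _ => .of_discrete),
    poissonCylinderProb, ENNReal.ofReal_prod_of_nonneg fun k _ =>
      poissonWeight_nonneg (poissonRate_nonneg ha hx k) _]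
  exact Finset.prod_congr rfl fun k _ => poissonMarginal_valueSet ha hx k _

theorem poissonProduct_eval (a x : ℝ) (k : ℕ+) (s : Set ℕ∞) :
    poissonProduct a x {w | w k ∈ s} = poissonMarginal a x k s := by
  rw [poissonProduct_eq, ← Measure.infinitePi_map_eval (poissonMarginal a x) k,
    Measure.map_apply (measurable_pi_apply k) .of_discrete]
  rfl

theorem poissonProduct_ne_zero_le {a x : ℝ} (ha : 0 < a) (hx : x ∈ Set.Icc (0 : ℝ) 1) (k : ℕ+) :
    poissonProduct a x {w | w k ≠ 0} ≤ ENNReal.ofReal (a * (1 - x)) := by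
  have h0 : ({c : ℕ∞ | c ≠ 0}) = (valueSet 0)ᶜ := by
    have := valueSet_natCast 0
    rw [Nat.cast_zero, Nat.cast_zero] at this
    rw [this]; rfl
  have h1 := poissonProduct_eval a x k {c | c ≠ 0}
  have hw : poissonWeight (poissonRate a k x) 0 = Real.exp (-poissonRate a k x) := by
    simp [poissonWeight]
  change poissonProduct a x {w | w k ≠ 0} = _ at h1
  rw [h1, h0, prob_compl_eq_one_sub .of_discrete, poissonMarginal_valueSet ha hx, hw,
    ← ENNReal.ofReal_one, ← ENNReal.ofReal_sub _ (Real.exp_pos _).le]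
  refine ENNReal.ofReal_le_ofReal ?_
  -- For a Poisson mean `l`, `1 - exp (-l) ≤ l`, and here `l ≤ a (1 - x)`.
  linarith [poissonRate_le ha hx k, Real.add_one_le_exp (-poissonRate a k x)]

/-- The `Beta(c, a + 1)` mixture of the Poisson products. -/
noncomputable def betaPoissonLaw (a c : ℝ) : Measure CountVec :=
  (betaMeasure c (a + 1)).bind (poissonProduct a)

theorem betaPoissonLaw_apply (a c : ℝ) {s : Set CountVec} (hs : MeasurableSet s) :
    betaPoissonLaw a c s = ∫⁻ x in Set.Ioo (0 : ℝ) 1,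
      ENNReal.ofReal (x ^ (c - 1) * (1 - x) ^ a / beta c (a + 1)) * poissonProduct a x s := by
  have hm : Measurable (betaPDF c (a + 1)) := (measurable_betaPDFReal c (a + 1)).ennreal_ofReal
  have hp : Measurable fun x => poissonProduct a x s :=
    (Measure.measurable_coe hs).comp (measurable_poissonProduct a)
  rw [betaPoissonLaw, Measure.bind_apply hs (measurable_poissonProduct a).aemeasurable, betaMeasure,
    lintegral_withDensity_eq_lintegral_mul _ hm hp, ← lintegral_indicator measurableSet_Ioo]
  refine lintegral_congr fun x => ?_
  by_cases hx : x ∈ Set.Ioo (0 : ℝ) 1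
  · rw [Set.indicator_of_mem hx, Pi.mul_apply, betaPDF_of_pos_lt_one hx.1 hx.2]
    congr 2
    rw [add_sub_cancel_right]
    ring
  · rw [Set.indicator_of_notMem hx, Pi.mul_apply, betaPDF_eq]
    have : ¬ (0 < x ∧ x < 1) := hx
    simp [this]

theorem isProbabilityMeasure_betaPoissonLaw {a c : ℝ} (ha : 0 < a) (hc : 0 < c) :
    IsProbabilityMeasure (betaPoissonLaw a c) := by
  have := isProbabilityMeasureBeta hc (show 0 < a + 1 by linarith)
  refine ⟨?_⟩
  rw [betaPoissonLaw, Measure.bind_apply .univ (measurable_poissonProduct a).aemeasurable]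
  simp

theorem betaPoissonLaw_countCylinder {a c : ℝ} (ha : 0 < a) (hc : 0 < c) (I : Finset ℕ+)
    (z : ℕ+ → ℤ) :
    (betaPoissonLaw a c).real (countCylinder I z) =
      betaPoissonIntegral a I c z / beta c (a + 1) := by
  have hb := beta_pos hc (show 0 < a + 1 by linarith)
  rw [Measure.real, betaPoissonLaw_apply a c (measurableSet_countCylinder I z), betaPoissonIntegral,
    ← integral_div, integral_eq_lintegral_of_nonneg_ae]
  · congr 1
    refine setLIntegral_congr_fun measurableSet_Ioo fun x hx => ?_
    have hx' : x ∈ Set.Icc (0 : ℝ) 1 := ⟨hx.1.le, hx.2.le⟩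
    have h1 := Real.rpow_nonneg hx.1.le (c - 1)
    have h2 := Real.rpow_nonneg (sub_nonneg.2 hx.2.le) a
    rw [poissonProduct_countCylinder ha hx', ← ENNReal.ofReal_mul (by positivity)]
    congr 1
    ring
  · refine ae_restrict_of_forall_mem measurableSet_Ioo fun x hx => ?_
    have h1 := Real.rpow_nonneg hx.1.le (c - 1)
    have h2 := Real.rpow_nonneg (sub_nonneg.2 hx.2.le) a
    have h3 := poissonCylinderProb_nonneg ha ⟨hx.1.le, hx.2.le⟩ I z
    change 0 ≤ x ^ (c - 1) * (1 - x) ^ a * poissonCylinderProb a I z x / beta c (a + 1)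
    positivity
  · have := (continuous_poissonCylinderProb a I z).measurable
    exact Measurable.aestronglyMeasurable (by fun_prop)

/-- The conditional probability is at most `a (1 - x)`. The factor `1 - x` turns the `Beta(c, a+1)`
density into a multiple of the `Beta(c, a+2)` density, so the bound integrates to `a(a+1)/(c+a+1)`.
-/
theorem betaPoissonLaw_ne_zero_le {a c : ℝ} (ha : 0 < a) (hc : 0 < c) (d : ℕ+) :
    betaPoissonLaw a c {w | w d ≠ 0} ≤ ENNReal.ofReal (a * (a + 1) / c) := by
  have ha1 : 0 < a + 1 := by linarith
  have hb := beta_pos hc ha1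
  have hb2 := beta_pos hc (show 0 < a + 1 + 1 by linarith)
  have hms : MeasurableSet {z : CountVec | z d ≠ 0} :=
    measurable_pi_apply (X := fun _ : ℕ+ => ℕ∞) d (MeasurableSet.of_discrete (s := {c | c ≠ 0}))
  have hr := beta_add_one_right hc ha1
  have hpt : ∀ x ∈ Set.Ioo (0 : ℝ) 1,
      ENNReal.ofReal (x ^ (c - 1) * (1 - x) ^ a / beta c (a + 1)) *
        poissonProduct a x {w | w d ≠ 0} ≤
      ENNReal.ofReal (a * (a + 1) / c) * ENNReal.ofReal
        (1 / beta c (a + 1 + 1) * x ^ (c - 1) * (1 - x) ^ (a + 1 + 1 - 1)) := by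
    intro x hx
    have hx1 : 0 < 1 - x := sub_pos.2 hx.2
    have h1 := Real.rpow_nonneg hx.1.le (c - 1)
    have h2 := Real.rpow_nonneg hx1.le a
    refine (mul_le_mul_right (poissonProduct_ne_zero_le ha ⟨hx.1.le, hx.2.le⟩ d) _).trans ?_
    rw [← ENNReal.ofReal_mul (by positivity), ← ENNReal.ofReal_mul (by positivity)]
    refine ENNReal.ofReal_le_ofReal ?_
    rw [add_sub_cancel_right, Real.rpow_add_one hx1.ne', hr]
    have h3 : a * (a + 1) / c *
        (1 / (beta c (a + 1) * ((a + 1) / (c + (a + 1)))) * x ^ (c - 1) *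
          ((1 - x) ^ a * (1 - x))) =
        x ^ (c - 1) * (1 - x) ^ a / beta c (a + 1) * (a * (1 - x)) * ((c + (a + 1)) / c) := by
      field_simp
    rw [h3]
    refine le_mul_of_one_le_right (by positivity) ?_
    rw [one_le_div hc]
    linarith
  rw [betaPoissonLaw_apply a c hms]
  refine (setLIntegral_mono' measurableSet_Ioo hpt).trans ?_
  rw [lintegral_const_mul _ (by fun_prop), ← lintegral_betaPDF,
    lintegral_betaPDF_eq_one hc (by linarith), mul_one]

theorem betaPoissonLaw_eval_top (a c : ℝ) (d : ℕ+) :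
    betaPoissonLaw a c {w | w d = ⊤} = 0 := by
  have hms : MeasurableSet {z : CountVec | z d = ⊤} :=
    measurable_pi_apply (X := fun _ : ℕ+ => ℕ∞) d (MeasurableSet.of_discrete (s := {c | c = ⊤}))
  have h : ∀ x, poissonProduct a x {w | w d = ⊤} = 0 := by
    intro x
    have hpre : (Nat.cast : ℕ → ℕ∞) ⁻¹' {c | c = ⊤} = ∅ := by ext; simp
    have h1 := poissonProduct_eval a x d {c | c = ⊤}
    change poissonProduct a x {w | w d = ⊤} = _ at h1
    rw [h1, poissonMarginal, Measure.map_apply .of_discrete .of_discrete, hpre, measure_empty]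
  rw [betaPoissonLaw_apply a c hms]
  simp [h]

end Mixture

/-! ### Uniqueness of the solution and identification of the laws -/

section Uniqueness

theorem hasSum_countLaw_countCylinder {a b : ℝ} (ha : 0 < a) (hb : 0 ≤ b) (I : Finset ℕ+)
    (z : ℕ+ → ℤ) :
    HasSum (fun m : ℕ+ => secondOneProb a b ((m : ℕ) + 1) *
      (countLaw a (b + (m : ℝ))).real (countCylinder I (z - Pi.single m 1)))
      ((countLaw a b).real (countCylinder I z)) := by
  have h : countLaw a b (countCylinder I z) = ∑' m : ℕ+,
      ENNReal.ofReal (secondOneProb a b ((m : ℕ) + 1)) *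
        countLaw a (b + (m : ℝ)) (countCylinder I (z - Pi.single m 1)) := by
    conv_lhs => rw [countLaw_eq_sum_pnat ha hb]
    rw [Measure.sum_apply _ (measurableSet_countCylinder I z)]
    refine tsum_congr fun m => ?_
    rw [Measure.smul_apply, Measure.map_apply (measurable_add_unitVec m)
      (measurableSet_countCylinder I z), preimage_add_unitVec_countCylinder, smul_eq_mul]
  have hne : ∑' m : ℕ+, ENNReal.ofReal (secondOneProb a b ((m : ℕ) + 1)) *
      countLaw a (b + (m : ℝ)) (countCylinder I (z - Pi.single m 1)) ≠ ∞ :=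
    h ▸ measure_ne_top _ _
  have hs := ENNReal.hasSum_toReal hne
  rw [← ENNReal.tsum_toReal_eq fun m => ENNReal.ne_top_of_tsum_ne_top hne m, ← h] at hs
  simpa only [ENNReal.toReal_mul,
    ENNReal.toReal_ofReal (secondOneProb_nonneg ha hb (Nat.succ_le_succ (PNat.pos _)))] using! hs

/-- A family obeying the averaging recursion with weights `p` is determined by its behaviour at
infinity. -/
theorem eq_of_averaging_recursion {Z : Type*} (p : ℝ → ℕ+ → ℝ) (σ : ℕ+ → Z → Z)
    (U V : ℝ → Z → ℝ) (B : ℝ) (hB : 0 ≤ B)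
    (hp : ∀ c, 0 < c → ∀ m, 0 ≤ p c m) (hp1 : ∀ c, 0 < c → HasSum (p c) 1)
    (hU : ∀ c, 0 < c → ∀ z, HasSum (fun m : ℕ+ => p c m * U (c + (m : ℝ)) (σ m z)) (U c z))
    (hV : ∀ c, 0 < c → ∀ z, HasSum (fun m : ℕ+ => p c m * V (c + (m : ℝ)) (σ m z)) (V c z))
    (hUV : ∀ c, 0 < c → ∀ z, |U c z - V c z| ≤ B / c) {c : ℝ} (hc : 0 < c) (z : Z) :
    U c z = V c z := by
  -- The weights sum to 1 and every `m ≥ 1`, so a bound `B/(c+m+N)` at `c + m` averages to at most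
  -- `B/(c+N+1)` at `c`.
  have key : ∀ N : ℕ, ∀ c, 0 < c → ∀ z, |U c z - V c z| ≤ B / (c + N) := by
    intro N
    induction N with
    | zero => simpa using hUV
    | succ N ih =>
      intro c hc z
      have hd := (hU c hc z).sub (hV c hc z)
      have hle : ∀ m : ℕ+, |p c m * U (c + (m : ℝ)) (σ m z) - p c m * V (c + (m : ℝ)) (σ m z)| ≤
          p c m * (B / (c + (N + 1 : ℕ))) := by
        intro m
        have hm : (1 : ℝ) ≤ (m : ℝ) := by exact_mod_cast (one_le (a := m))
        rw [← mul_sub, abs_mul, abs_of_nonneg (hp c hc m)]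
        refine mul_le_mul_of_nonneg_left ?_ (hp c hc m)
        refine (ih (c + m) (by linarith) (σ m z)).trans ?_
        refine div_le_div_of_nonneg_left hB (by positivity) ?_
        push_cast
        linarith
      have hs := (hp1 c hc).mul_right (B / (c + (N + 1 : ℕ)))
      rw [one_mul] at hs
      have h1 := hasSum_le (fun m => (abs_le.1 (hle m)).2) hd hs
      have h2 := hasSum_le (fun m => (abs_le.1 (hle m)).1) hs.neg hd
      exact abs_le.2 ⟨h2, h1⟩
  have hlim : Tendsto (fun N : ℕ => B / (c + N)) atTop (𝓝 0) :=
    (tendsto_atTop_add_const_left _ c tendsto_natCast_atTop_atTop).const_div_atTop B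
  have h0 : |U c z - V c z| ≤ 0 := ge_of_tendsto' hlim fun N => key N c hc z
  exact sub_eq_zero.1 (abs_nonpos_iff.1 h0)

/-- Both laws are nearly concentrated on the zero vector along `I`. If `z` vanishes on `I`, both
cylinders have probability close to 1; otherwise both have probability close to 0. The bound does
not depend on `z`. -/
theorem abs_sub_countCylinder_le (μ ν : Measure CountVec) [IsProbabilityMeasure μ]
    [IsProbabilityMeasure ν] (I : Finset ℕ+) (z : ℕ+ → ℤ) {ε : ℝ}
    (hμ : ∀ d, μ {w | w d ≠ 0} ≤ ENNReal.ofReal ε)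
    (hν : ∀ d, ν {w | w d ≠ 0} ≤ ENNReal.ofReal ε) (hε : 0 ≤ ε) :
    |μ.real (countCylinder I z) - ν.real (countCylinder I z)| ≤ I.card * ε := by
  have hbound : ∀ (ρ : Measure CountVec) [IsProbabilityMeasure ρ],
      (∀ d, ρ {w | w d ≠ 0} ≤ ENNReal.ofReal ε) → ∀ A ⊆ ⋃ d ∈ I, {w : CountVec | w d ≠ 0},
        ρ.real A ≤ I.card * ε := by
    intro ρ _ hρ A hA
    refine (measureReal_mono hA (measure_ne_top _ _)).trans ((measureReal_biUnion_finset_le _ _).trans ?_)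
    refine (Finset.sum_le_card_nsmul _ _ ε fun d _ => ?_).trans (by rw [nsmul_eq_mul])
    exact ENNReal.toReal_le_of_le_ofReal hε (hρ d)
  by_cases hz : ∀ k ∈ I, z k = 0
  · have hsub : (countCylinder I z)ᶜ ⊆ ⋃ d ∈ I, {w : CountVec | w d ≠ 0} := by
      intro w hw
      by_contra hc
      simp only [Set.mem_iUnion, not_exists, Set.mem_ofPred_eq, not_not] at hc
      refine hw fun k hk => ?_
      have hk' : k ∈ I := hk
      exact ⟨0, by simp [hc k hk'], by simp [hz k hk']⟩
    have h1 := hbound μ hμ _ hsub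
    have h2 := hbound ν hν _ hsub
    rw [probReal_compl_eq_one_sub (measurableSet_countCylinder I z)] at h1 h2
    have h3 : μ.real (countCylinder I z) ≤ 1 := measureReal_le_one
    have h4 : ν.real (countCylinder I z) ≤ 1 := measureReal_le_one
    rw [abs_le]
    constructor <;> linarith
  · push Not at hz
    obtain ⟨k, hk, hzk⟩ := hz
    have hsub : countCylinder I z ⊆ ⋃ d ∈ I, {w : CountVec | w d ≠ 0} := by
      intro w hw
      refine Set.mem_iUnion₂.2 ⟨k, hk, fun h0 => ?_⟩
      obtain ⟨n, hn, hn'⟩ := hw k hk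
      rw [h0, Nat.cast_eq_zero] at hn
      subst hn
      exact hzk hn'.symm
    have h1 := hbound μ hμ _ hsub
    have h2 := hbound ν hν _ hsub
    have h3 : 0 ≤ μ.real (countCylinder I z) := measureReal_nonneg
    have h4 : 0 ≤ ν.real (countCylinder I z) := measureReal_nonneg
    rw [abs_le]
    constructor <;> linarith

theorem countLaw_countCylinder_eq {a c : ℝ} (ha : 0 < a) (hc : 0 < c) (I : Finset ℕ+)
    (z : ℕ+ → ℤ) :
    (countLaw a (c + 1)).real (countCylinder I z) =
      (betaPoissonLaw a c).real (countCylinder I z) := by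
  refine eq_of_averaging_recursion (fun c m => secondOneProb a (c + 1) ((m : ℕ) + 1))
    (fun m z => z - Pi.single m 1) (fun c z => (countLaw a (c + 1)).real (countCylinder I z))
    (fun c z => (betaPoissonLaw a c).real (countCylinder I z)) (I.card * (a * (a + 1)))
    (by positivity) (fun c hc m => secondOneProb_nonneg ha (by linarith) (Nat.succ_le_succ m.pos))
    (fun c hc => hasSum_secondOneProb_pnat ha (by linarith)) (fun c hc z => ?_) (fun c hc z => ?_)
    (fun c hc z => ?_) hc z
  · have h := hasSum_countLaw_countCylinder ha (show 0 ≤ c + 1 by linarith) I z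
    simpa only [add_right_comm] using h
  · rw [betaPoissonLaw_countCylinder ha hc]
    convert! hasSum_betaPoisson ha hc I z using 2 with m
    have hm : (0 : ℝ) < (m : ℝ) := by exact_mod_cast m.pos
    rw [betaPoissonLaw_countCylinder ha (by linarith)]
  · have := isProbabilityMeasure_betaPoissonLaw ha hc
    rw [mul_div_assoc]
    refine abs_sub_countCylinder_le _ _ I z (fun d => ?_)
      (fun d => betaPoissonLaw_ne_zero_le ha hc d) (by positivity)
    refine (countLaw_ne_zero_le ha (show 0 ≤ c + 1 by linarith) d).trans
      (ENNReal.ofReal_le_ofReal (div_le_div_of_nonneg_left (by positivity) hc (by linarith)))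

/-- Two laws of count vectors which agree on cylinders are equal if one of them is carried by the
finite counts. -/
theorem ext_of_countCylinder (μ ν : Measure CountVec) [IsProbabilityMeasure μ]
    [IsProbabilityMeasure ν] (htop : ∀ d, ν {w | w d = ⊤} = 0)
    (h : ∀ I z, μ.real (countCylinder I z) = ν.real (countCylinder I z)) : μ = ν := by
  refine IsProjectiveLimit.unique (P := fun I => ν.map I.restrict) (fun I => ?_) fun I => rfl
  have hm : Measurable (I.restrict (π := fun _ : ℕ+ => ℕ∞)) := Finset.measurable_restrict I
  have := Measure.isProbabilityMeasure_map (μ := μ) hm.aemeasurable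
  have := Measure.isProbabilityMeasure_map (μ := ν) hm.aemeasurable
  -- Between probability measures, domination of the marginal of `ν` by that of `μ` is enough.
  -- Points with an infinite coordinate are then harmless because `ν` ignores them; finiteness of
  -- the counts under `μ` follows instead of being assumed.
  refine (Measure.eq_of_le_of_isProbabilityMeasure ?_).symm
  refine Measure.le_intro fun s _ _ => ?_
  rw [← Measure.tsum_indicator_apply_singleton _ s .of_discrete,
    ← Measure.tsum_indicator_apply_singleton _ s .of_discrete]
  refine ENNReal.tsum_le_tsum fun f => Set.indicator_le_indicator ?_
  rw [Measure.map_apply hm (measurableSet_singleton f),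
    Measure.map_apply hm (measurableSet_singleton f)]
  by_cases hf : ∀ k, f k ≠ ⊤
  · have hset : I.restrict (π := fun _ : ℕ+ => ℕ∞) ⁻¹' {f} =
        countCylinder I fun k => if hk : k ∈ I then ((f ⟨k, hk⟩).toNat : ℤ) else 0 := by
      ext w
      simp only [Set.mem_preimage, Set.mem_singleton_iff, funext_iff, countCylinder, Set.mem_pi,
        Finset.mem_coe, Subtype.forall, Finset.restrict]
      refine forall₂_congr fun k hk => ?_
      rw [dif_pos hk, valueSet_natCast, ENat.natCast_toNat (hf ⟨k, hk⟩), Set.mem_singleton_iff]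
    rw [hset]
    exact ((measureReal_eq_measureReal_iff).1 (h I _)).ge
  · push Not at hf
    obtain ⟨k, hk⟩ := hf
    have hsub : I.restrict (π := fun _ : ℕ+ => ℕ∞) ⁻¹' {f} ⊆ {w : CountVec | w k = ⊤} := by
      intro w hw
      rw [Set.mem_preimage, Set.mem_singleton_iff] at hw
      rw [Set.mem_ofPred_eq, ← hk, ← hw]
      rfl
    rw [measure_mono_null hsub (htop k)]
    exact zero_le

theorem countLaw_add_one_eq {a c : ℝ} (ha : 0 < a) (hc : 0 < c) :
    countLaw a (c + 1) = (betaMeasure c (a + 1)).bind (poissonProduct a) := by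
  have := isProbabilityMeasure_betaPoissonLaw ha hc
  exact ext_of_countCylinder _ (betaPoissonLaw a c) (betaPoissonLaw_eval_top a c)
    (countLaw_countCylinder_eq ha hc)

end Uniqueness

end BernoulliStrings

theorem proposition4p2 (a b : ℝ) (ha : 0 < a) (hb : 0 ≤ b) :
    -- `p_n` is the probability that the second `1` occurs at time `n`, and the `p_n` sum to `1`
    (∀ n : ℕ, 2 ≤ n →
      BernoulliStrings.bernOneLaw a b {y | BernoulliStrings.SecondOneAt y n} =
        ENNReal.ofReal (BernoulliStrings.secondOneProb a b n)) ∧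
    (∀ n : ℕ, 2 ≤ n → 0 ≤ BernoulliStrings.secondOneProb a b n) ∧
    HasSum (fun n : {n : ℕ // 2 ≤ n} => BernoulliStrings.secondOneProb a b n) 1 ∧
    -- the law of `Z(a,b)` is the mixture of the laws of `Z(a,b+n-1) + W_{n-1}`
    BernoulliStrings.countLaw a b =
      Measure.sum (fun n : {n : ℕ // 2 ≤ n} =>
        ENNReal.ofReal (BernoulliStrings.secondOneProb a b n) •
          (BernoulliStrings.countLaw a (b + ((n : ℕ) : ℝ) - 1)).map
            (fun z => z + BernoulliStrings.unitVec ((n : ℕ) - 1))) ∧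
    -- the law of `Z(a,b+n-1)` is a Beta mixture of products of Poisson laws
    (0 < b → ∀ n : ℕ, 2 ≤ n →
      BernoulliStrings.countLaw a (b + (n : ℝ) - 1) =
        (betaMeasure (b + (n : ℝ) - 2) (a + 1)).bind
          (BernoulliStrings.poissonProduct a)) := by
  refine ⟨fun n hn => BernoulliStrings.bernOneLaw_secondOneAt ha hb hn,
    fun n hn => BernoulliStrings.secondOneProb_nonneg ha hb hn,
    BernoulliStrings.hasSum_secondOneProb ha hb, BernoulliStrings.countLaw_eq_sum ha hb,
    fun hb0 n hn => ?_⟩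
  have hn' : (2 : ℝ) ≤ n := by exact_mod_cast hn
  have h := BernoulliStrings.countLaw_add_one_eq ha (show 0 < b + (n : ℝ) - 2 by linarith)
  rwa [show b + (n : ℝ) - 2 + 1 = b + (n : ℝ) - 1 by ring] at h
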